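/- Setting. For a finite list $S$ of vectors of $\mathbb{R}^d$ let $\bm{c}_S=\frac1{|S|}\sum_{\bm p\in S}\bm p$ be its centroid and $R_S=\max_{\bm p\in S}\|\bm p-\bm c_S\|$ its radius. The shifting-invariant asymmetric transformation maps an item $\bm p\in S$ to $I(\bm p)=[\bm p-\bm c_S;\sqrt{R_S^2-\|\bm p-\bm c_S\|^2}]\in\mathbb{R}^{d+1}$ and a user vector $\bm u$ to $U(\bm u)=[\tfrac{R_S}{\|\bm u\|}\bm u;0]$. A hash function $h_{sa}$ takes an item $\bm p$ to the sign of $\langle\bm a,I(\bm p)\rangle$ and a user vector $\bm u$ to the sign of $\langle \bm a,U(\bm u)\rangle$, where $\bm a$ has i.i.d. standard normal entries. Write $p(\delta)=1-\delta/\pi$. The SA-ALSH data structure for a set $\mathcal P\subset\mathbb{R}^d$ of $n$ items and an interval ratio $b<1$ sorts $\mathcal P$ by descending norm and cuts it greedily into $t$ partitions $S_1,\dots,S_t$: a partition starts with an item of norm $M_j$ and takes the following items as long as their norm exceeds $bM_j$ (for $b<0$ there is no partitioning: $t=1$, $S_1=\mathcal P$). For each partition it stores $K$ hash tables, in which the key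 of an item consists of its values under $m$ independent functions $h_{sa}$ of this partition. A query $\bm u$ goes through the partitions in order, ends as soon as the best inner product found exceeds $M_j\|\bm u\|$, and otherwise computes the inner products of $\bm u$ with the items in the buckets of $\bm u$ in the $K$ tables of $S_j$, inspecting at most $B$ candidates per partition; it returns the best item found. Time counts each arithmetic operation, comparison and memory access; space counts words that hold a real number, a pointer, or $\lceil\log_2 n\rceil$ bits of a key. Theorem. Let $0<p_2<p_1\le 1$ and $\rho=\ln(1/p_1)/\ln(1/p_2)$. There is a constant $C>0$, depending only on $p_1,p_2$, such that for every $n\ge2$ there are $K,m,B$ (depending only on $n,p_1,p_2$) such that for all $d$, all $\mathcal P\subset\mathbb{R}^d$ with $|\mathcal P|=n$ and all $b<1$ the following holds. (1) For every choice of the hash functions, a query takes at most $C\,t\,d\,n^{\rho}\log_{1/p_2}n$ steps (that is, $O(d\,n^\rho\log_{1/p_2}n)$ when the number $t$ of partitions is bounded, in particular without partitioning); the hash tables take at most $C\,n^{1+\rho}$ words; and the hash tables together with the item vectors and the hash functions take at most $C\,(n^{1+\rho}+dn+t\,d\,n^\rho\log_{1/p_2}n)$ words. (2) Let $c>1$,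 let $\bm u\in\mathbb{R}^d$, let $\bm p^*\in\mathcal P$ maximize $\langle\bm p,\bm u\rangle$ over $\mathcal P$, let $S$ be the partition that contains $\bm p^*$, and suppose, if $R_S>0$, that $p_1\le p\big(\arccos\frac{\langle\bm p^*-\bm c_S,\bm u\rangle}{R_S\|\bm u\|}\big)$. (a) If $\langle\bm p^*,\bm u\rangle>0$ and, in the case $R_S>0$, $p\big(\arccos\frac{\langle\bm p^*,\bm u\rangle/c-\langle\bm c_S,\bm u\rangle}{R_S\|\bm u\|}\big)\le p_2$ (with $\arccos$ constant outside $[-1,1]$), then with probability at least $1/2$ the query returns an item $\bm p\in\mathcal P$ with $\langle\bm p,\bm u\rangle\ge\langle\bm p^*,\bm u\rangle/c$. (b) If, in the case $R_S>0$, $p\big(\arccos\frac{\langle\bm p^*-\bm c_S,\bm u\rangle}{cR_S\|\bm u\|}\big)\le p_2$, then with probability at least $1/2$ the query returns an item $\bm p\in\mathcal P$ with $\langle\bm p-\bm c_S,\bm u\rangle\ge\langle\bm p^*-\bm c_S,\bm u\rangle/c$, and hence with $\langle\bm p,\bm u\rangle\ge\langle\bm p^*,\bm u\rangle/c$ if $\langle\bm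 c_S,\bm u\rangle\ge0$. -/

import Mathlib

open MeasureTheory ProbabilityTheory
open scoped InnerProductSpace

noncomputable section

namespace SAALSH

/-- Vectors of `ℝ^k` with the Euclidean norm. -/
abbrev Vec (k : ℕ) : Type := EuclideanSpace ℝ (Fin k)

/-! ### Step counting (real RAM: one step per arithmetic operation, comparison or memory access) -/

/-- A computed value together with the number of elementary steps spent on it. -/
structure Cost (α : Type) where
  val : α
  steps : ℕ

instance : Monad Cost where
  pure a := ⟨a, 0⟩
  bind x f := ⟨(f x.val).val, x.steps + (f x.val).steps⟩

/-- Inner product of two `k`-dimensional vectors: `k` multiplications and `k` additions. -/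
def dotC {k : ℕ} (x y : Vec k) : Cost ℝ := ⟨⟪x, y⟫_ℝ, 2 * k⟩

/-- Euclidean norm: an inner product and a square root. -/
def normC {k : ℕ} (x : Vec k) : Cost ℝ := ⟨‖x‖, 2 * k + 1⟩

/-- Product of two reals. -/
def mulC (x y : ℝ) : Cost ℝ := ⟨x * y, 1⟩

/-! ### The shifting-invariant asymmetric transformation -/

/-- The centroid of a list of items. -/
def centroid {d : ℕ} (S : List (Vec d)) : Vec d := (S.length : ℝ)⁻¹ • S.sum

/-- Maximum of a list of nonnegative reals (`0` for the empty list). -/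
def maxOf (l : List ℝ) : ℝ := l.foldr max 0

/-- The radius of the smallest ball around the centroid that contains all items. -/
def radius {d : ℕ} (S : List (Vec d)) : ℝ := maxOf (S.map fun p => ‖p - centroid S‖)

/-- Item transformation `I(p, c) = [p - c ; √(R² - ‖p - c‖²)]`. -/
def itemMap {d : ℕ} (c : Vec d) (R : ℝ) (p : Vec d) : Vec (d + 1) :=
  WithLp.toLp 2 (Fin.snoc (α := fun _ => ℝ) (fun i => p i - c i) (Real.sqrt (R ^ 2 - ‖p - c‖ ^ 2)))

/-- User transformation `U(u) = [λ u ; 0]`, where `λ = R / ‖u‖`. -/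
def userMap {d : ℕ} (R : ℝ) (u : Vec d) : Vec (d + 1) :=
  WithLp.toLp 2 (Fin.snoc (α := fun _ => ℝ) (fun i => R / ‖u‖ * u i) 0)

/-- Computing `U(u)` once `‖u‖` is known: a division, `d` multiplications, and storing the `0`. -/
def userMapC {d : ℕ} (R : ℝ) (u : Vec d) : Cost (Vec (d + 1)) := ⟨userMap R u, d + 2⟩

/-! ### SimHash -/

open Classical in
/-- Sign random projection `h(x) = sgn ⟨a, x⟩`, with the sign stored as a bit. -/
def srp {k : ℕ} (a x : Vec k) : Bool := decide (0 ≤ ⟪a, x⟫_ℝ)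

/-- Evaluating one hash function: an inner product and a comparison. -/
def srpC {k : ℕ} (a x : Vec k) : Cost Bool := ⟨srp a x, 2 * k + 1⟩

/-- Collision probability of sign random projection for two vectors at angle `δ`. -/
def srpProb (δ : ℝ) : ℝ := 1 - δ / Real.pi

/-- Evaluating the hash functions of a table one after the other. -/
def keyC {k : ℕ} : List (Vec k) → Vec k → Cost (List Bool)
  | [], _ => pure []
  | a :: as, x => do
      let bit ← srpC a x
      let rest ← keyC as x
      pure (bit :: rest)

/-- A hash table: its hash functions, and a dictionary holding each item under its key. -/
structure Table (d : ℕ) where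
  funs : List (Vec (d + 1))
  entries : List (List Bool × Vec d)

open Classical in
/-- The items stored under a key. -/
def Table.bucket {d : ℕ} (T : Table d) (key : List Bool) : List (Vec d) :=
  (T.entries.filter fun e => decide (e.1 = key)).map Prod.snd

/-- Locating a bucket: reading every bit of the key, and one access.
(Reading the items of the bucket is charged when they are scanned.) -/
def Table.lookupC {d : ℕ} (T : Table d) (key : List Bool) : Cost (List (Vec d)) :=
  ⟨T.bucket key, key.length + 1⟩

/-- The index of one partition. -/
structure Block (d : ℕ) where
  maxNorm : ℝ
  radius : ℝ
  tables : List (Table d)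

/-! ### Indexing -/

open Classical in
/-- The items of `P` in descending order of their norms. -/
def sortedItems {d : ℕ} (P : Finset (Vec d)) : List (Vec d) :=
  P.toList.insertionSort fun p q => ‖q‖ ≤ ‖p‖

open Classical in
/-- Greedy norm-based partitioning of a descending list: a partition starts with an item of norm `M`
and takes the following items as long as their norm exceeds `b * M`. -/
def normBlocks {d : ℕ} (b : ℝ) : List (Vec d) → List (List (Vec d))
  | [] => []
  | p :: l =>
      (p :: l.takeWhile fun q => decide (b * ‖p‖ < ‖q‖)) ::
        normBlocks b (l.dropWhile fun q => decide (b * ‖p‖ < ‖q‖))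
termination_by l => l.length
decreasing_by
  have h := (List.dropWhile_sublist (l := l) fun q => decide (b * ‖p‖ < ‖q‖)).length_le
  simp only [List.length_cons]
  omega

/-- The partitions of the item set `P` for the interval ratio `b`. For `b < 0` there is only one. -/
def partitions {d : ℕ} (b : ℝ) (P : Finset (Vec d)) : List (List (Vec d)) :=
  normBlocks b (sortedItems P)

/-- One hash table for the partition `S`: the key of an item `p` consists of the bits
`h(I(p, c))`, where `g` holds the random directions of the hash functions `h`. -/
def buildTable {d m : ℕ} (S : List (Vec d)) (g : Fin m → Fin (d + 1) → ℝ) : Table d where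
  funs := List.ofFn fun i => WithLp.toLp 2 (g i)
  entries := S.map fun p =>
    (List.ofFn fun i => srp (WithLp.toLp 2 (g i)) (itemMap (centroid S) (radius S) p), p)

/-- The index of the partition `S`, with `K` hash tables of `m` hash functions each. -/
def buildBlock {d K m : ℕ} (S : List (Vec d)) (g : Fin K → Fin m → Fin (d + 1) → ℝ) : Block d where
  maxNorm := maxOf (S.map fun p => ‖p‖)
  radius := radius S
  tables := List.ofFn fun k => buildTable S (g k)

/-- The random directions for `t` partitions, `K` tables and `m` hash functions per table. -/
abbrev Directions (t K m d : ℕ) : Type := Fin t → Fin K → Fin m → Fin (d + 1) → ℝ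

/-- All entries of the random directions are independent standard normal variables. -/
def gaussianDirections (t K m d : ℕ) : Measure (Directions t K m d) :=
  Measure.pi fun _ => Measure.pi fun _ => Measure.pi fun _ => Measure.pi fun _ => gaussianReal 0 1

/-- The SA-ALSH index of `P`. -/
def index {d K m : ℕ} (b : ℝ) (P : Finset (Vec d))
    (a : Directions (partitions b P).length K m d) : List (Block d) :=
  List.ofFn fun j => buildBlock ((partitions b P).get j) (a j)

/-! ### Querying -/

open Classical in
/-- Keep the better of the best item found so far (`none` at the start) and the item `p` with inner
product `s`: one comparison. -/
def improveC {d : ℕ} (best : Option (ℝ × Vec d)) (s : ℝ) (p : Vec d) : Cost (Option (ℝ × Vec d)) :=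
  ⟨match best with
    | none => some (s, p)
    | some (φ, q) => if φ < s then some (s, p) else some (φ, q), 1⟩

open Classical in
/-- Test whether the largest inner product found so far exceeds the bound `μ`: one comparison. -/
def exceedsC {d : ℕ} (best : Option (ℝ × Vec d)) (μ : ℝ) : Cost Bool :=
  ⟨match best with
    | none => false
    | some (φ, _) => decide (μ < φ), 1⟩

/-- Compute the inner products of the items of a bucket with `u`, as long as the budget of candidates
is not exhausted. Returns the remaining budget and the best item. -/
def scanC {d : ℕ} (u : Vec d) :
    ℕ → List (Vec d) → Option (ℝ × Vec d) → Cost (ℕ × Option (ℝ × Vec d))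
  | B, [], best => pure (B, best)
  | 0, _ :: _, best => pure (0, best)
  | B + 1, p :: l, best => do
      let s ← dotC p u
      let best' ← improveC best s p
      scanC u B l best'

/-- SimHash search: go through the buckets of the transformed user vector `x` in all tables,
inspecting at most `B` candidates. -/
def simHashC {d : ℕ} (u : Vec d) (x : Vec (d + 1)) :
    ℕ → List (Table d) → Option (ℝ × Vec d) → Cost (Option (ℝ × Vec d))
  | _, [], best => pure best
  | B, T :: Ts, best => do
      let key ← keyC T.funs x
      let bucket ← T.lookupC key
      let r ← scanC u B bucket best
      simHashC u x r.1 Ts r.2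

/-- Go through the partitions and end as soon as the best inner product exceeds the bound
`M_j * ‖u‖` of the next partition. -/
def searchC {d : ℕ} (u : Vec d) (normU : ℝ) (B : ℕ) :
    List (Block d) → Option (ℝ × Vec d) → Cost (Option (ℝ × Vec d))
  | [], best => pure best
  | S :: rest, best => do
      let μ ← mulC S.maxNorm normU
      let pruned ← exceedsC best μ
      if pruned then pure best
      else do
        let x ← userMapC S.radius u
        let best' ← simHashC u x B S.tables best
        searchC u normU B rest best'

/-- The SA-ALSH query for `k = 1`: the item with the largest inner product among the candidates, and
the number of steps used. At most `B` candidates are inspected per partition. -/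
def query {d : ℕ} (B : ℕ) (I : List (Block d)) (u : Vec d) : Cost (Option (Vec d)) := do
  let normU ← normC u
  let best ← searchC u normU B I none
  pure (best.map Prod.snd)

/-! ### Space -/

/-- Memory words of a hash table, for words of `w` bits: per entry, the key, a pointer to the item
and two words for the dictionary. -/
def Table.words {d : ℕ} (w : ℕ) (T : Table d) : ℕ :=
  (T.entries.map fun e => (e.1.length + w - 1) / w + 3).sum

/-- Memory words of the hash tables of an index. -/
def tableWords {d : ℕ} (w : ℕ) (I : List (Block d)) : ℕ :=
  (I.map fun S => (S.tables.map fun T => T.words w).sum).sum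

/-- Memory words of the directions of the hash functions of an index. -/
def funWords {d : ℕ} (I : List (Block d)) : ℕ :=
  (I.map fun S => (S.tables.map fun T => T.funs.length * (d + 1)).sum).sum

/-- Memory words of the whole data structure for `n` items: the hash tables, the hash functions, two
numbers per partition, and the item vectors themselves. -/
def totalWords {d : ℕ} (w n : ℕ) (I : List (Block d)) : ℕ :=
  tableWords w I + funWords I + 2 * I.length + n * d

end SAALSH

end

/-! The item map pads p - c_S to norm R_S and the user map rescales u to norm R_S, so the cosine of
their angle is ⟨p - c_S, u⟩ / (R_S ‖u‖) when R_S > 0 and u ≠ 0. Within a partition, a larger inner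
product thus means a smaller angle. A Gaussian direction acts on two vectors at angle δ like a
planar Gaussian, and the directions on which two half-planes at angle δ agree have proportion 1 -
δ/π (`gaussian_srp_eq`). Hence p* collides with u under one function with probability at least p₁,
and each item below the threshold τ (a far item) with probability at most p₂.

The rest is the locality-sensitive hashing argument, with the parameters of `exists_parameters`. For
m = ⌈log_{1/p₂} n⌉ a table has on average at most n p₂^m ≤ 1 far collisions, so by Markov B = 4K or
more of them occur in K tables with probability at most 1/4. For K = ⌈(2/p₁) n^ρ⌉ one has K p₁^m ≥
2, so p* is missed by all tables with probability at most e⁻² ≤ 1/4. Outside these two events the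
budget B cannot be used up by far items before an item reaching τ is met (`simHashC_reaches`).

Partitioning does no harm: by Cauchy–Schwarz and the descending norms, no bound M_j ‖u‖ up to the
partition of p* can be exceeded, so this partition is searched (`query_index_reaches`). The time and
space bounds hold for every choice of directions. -/

noncomputable section

namespace SAALSH

/-! ### Collision probability of sign random projection -/

section Projection

variable {E : Type*} [NormedAddCommGroup E] [InnerProductSpace ℝ E] [FiniteDimensional ℝ E]
  [MeasurableSpace E] [BorelSpace E]

/-- A linear form in the two inner products is the inner product of `a` with one vector, so the
characteristic function of `stdGaussian` applies. -/
theorem charFun_map_inner_pair (x y : E) (t : WithLp 2 (ℝ × ℝ)) :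
    charFun ((stdGaussian E).map fun a => WithLp.toLp 2 (⟪a, x⟫_ℝ, ⟪a, y⟫_ℝ)) t =
      Complex.exp (-‖t.fst • x + t.snd • y‖ ^ 2 / 2) := by
  rw [← charFun_stdGaussian, charFun_apply, charFun_apply, integral_map]
  · congr 1 with a
    congr 3
    simp [WithLp.prod_inner_apply, inner_add_right, inner_smul_right]
  · fun_prop
  · fun_prop

/-- The transpose of the planar linear map is moved onto `t`, where the product Gaussian has a known
characteristic function. -/
theorem charFun_map_planar_pair (φ : ℝ) (t : WithLp 2 (ℝ × ℝ)) :
    charFun (((gaussianReal 0 1).prod (gaussianReal 0 1)).map fun g : ℝ × ℝ =>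
      WithLp.toLp 2 (g.1, Real.cos φ * g.1 + Real.sin φ * g.2)) t =
      Complex.exp (-((t.fst + t.snd * Real.cos φ) ^ 2 + (t.snd * Real.sin φ) ^ 2 : ℝ) / 2) := by
  have h : charFun (((gaussianReal 0 1).prod (gaussianReal 0 1)).map (WithLp.toLp 2))
      (WithLp.toLp 2 (t.fst + t.snd * Real.cos φ, t.snd * Real.sin φ)) =
      Complex.exp (-((t.fst + t.snd * Real.cos φ) ^ 2 + (t.snd * Real.sin φ) ^ 2 : ℝ) / 2) := by
    rw [charFun_prod, charFun_gaussianReal, charFun_gaussianReal, ← Complex.exp_add]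
    congr 1
    simp
    ring
  rw [← h, charFun_apply, charFun_apply, integral_map, integral_map]
  · congr 1 with a
    congr 3
    simp [WithLp.prod_inner_apply]
    ring
  all_goals fun_prop

/-- Both exponents equal the squared norm of the same combination of two unit vectors at angle `φ`.
`WithLp` only serves to give the pair a Euclidean structure for characteristic functions. -/
theorem map_inner_pair {x y : E} (hx : ‖x‖ = 1) (hy : ‖y‖ = 1) {φ : ℝ} (h : ⟪x, y⟫_ℝ = Real.cos φ) :
    (stdGaussian E).map (fun a => (⟪a, x⟫_ℝ, ⟪a, y⟫_ℝ)) =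
      ((gaussianReal 0 1).prod (gaussianReal 0 1)).map fun g : ℝ × ℝ =>
        (g.1, Real.cos φ * g.1 + Real.sin φ * g.2) := by
  have key : (stdGaussian E).map (fun a => WithLp.toLp 2 (⟪a, x⟫_ℝ, ⟪a, y⟫_ℝ)) =
      ((gaussianReal 0 1).prod (gaussianReal 0 1)).map fun g : ℝ × ℝ =>
        WithLp.toLp 2 (g.1, Real.cos φ * g.1 + Real.sin φ * g.2) := by
    have : IsProbabilityMeasure
        ((stdGaussian E).map (fun a => WithLp.toLp 2 (⟪a, x⟫_ℝ, ⟪a, y⟫_ℝ))) :=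
      Measure.isProbabilityMeasure_map (by fun_prop)
    have : IsProbabilityMeasure
      (((gaussianReal 0 1).prod (gaussianReal 0 1)).map fun g : ℝ × ℝ =>
        WithLp.toLp 2 (g.1, Real.cos φ * g.1 + Real.sin φ * g.2)) :=
      Measure.isProbabilityMeasure_map (by fun_prop)
    apply Measure.ext_of_charFun
    ext t
    rw [charFun_map_inner_pair, charFun_map_planar_pair]
    congr 3
    rw [← Complex.ofReal_pow, norm_add_sq_real, norm_smul, norm_smul, hx, hy, inner_smul_left,
      inner_smul_right, h]
    congr 1
    simp only [Real.norm_eq_abs, mul_one, sq_abs, conj_trivial]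
    have := Real.sin_sq_add_cos_sq φ
    linear_combination (-t.snd ^ 2) * this
  have := congrArg (fun μ => μ.map (WithLp.ofLp)) key
  rwa [Measure.map_map, Measure.map_map] at this
  all_goals fun_prop

end Projection

/-- A measurable cone of the plane has a Gaussian measure proportional to its angle. -/
theorem gaussian_prod_cone {A : Set (ℝ × ℝ)} (hA : MeasurableSet A) {Θ : Set ℝ}
    (hΘ : MeasurableSet Θ)
    (h : ∀ r > 0, ∀ θ ∈ Set.Ioo (-Real.pi) Real.pi,
      ((r * Real.cos θ, r * Real.sin θ) ∈ A ↔ θ ∈ Θ)) :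
    ((gaussianReal 0 1).prod (gaussianReal 0 1)) A =
      (∫⁻ r in Set.Ioi (0 : ℝ), ENNReal.ofReal r * ENNReal.ofReal
        ((2 * Real.pi)⁻¹ * Real.exp (-r ^ 2 / 2))) * volume (Θ ∩ Set.Ioo (-Real.pi) Real.pi) := by
  have hpdf : Measurable (gaussianPDF 0 1) := measurable_gaussianPDF 0 1
  have hprod : (gaussianReal 0 1).prod (gaussianReal 0 1) =
      (volume : Measure (ℝ × ℝ)).withDensity (fun z => gaussianPDF 0 1 z.1 * gaussianPDF 0 1 z.2) := by
    rw [gaussianReal_of_var_ne_zero 0 one_ne_zero, prod_withDensity hpdf hpdf]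
    rfl
  rw [hprod, withDensity_apply _ hA, ← lintegral_indicator hA, ← lintegral_comp_polarCoord_symm,
    polarCoord_target]
  have hvol : volume (Θ ∩ Set.Ioo (-Real.pi) Real.pi) =
      ∫⁻ θ in Set.Ioo (-Real.pi) Real.pi, Θ.indicator (fun _ => (1 : ENNReal)) θ := by
    rw [lintegral_indicator hΘ]
    simp [Measure.restrict_restrict hΘ]
  -- In polar coordinates the density depends on `r` only and membership on `θ` only, so the
  -- integral factors.
  rw [hvol, ← lintegral_prod_mul (by fun_prop) (by fun_prop (disch := exact hΘ)),
    Measure.prod_restrict]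
  refine setLIntegral_congr_fun (measurableSet_Ioi.prod measurableSet_Ioo) ?_
  rintro ⟨r, θ⟩ ⟨hr, hθ⟩
  simp only [Set.mem_Ioi] at hr hθ
  have hmem := h r hr θ hθ
  simp only [polarCoord_symm_apply, smul_eq_mul, mul_assoc]
  congr 1
  by_cases hc : θ ∈ Θ
  · rw [Set.indicator_of_mem (hmem.2 hc), Set.indicator_of_mem hc, mul_one, gaussianPDF,
      gaussianPDF, ← ENNReal.ofReal_mul (gaussianPDFReal_nonneg _ _ _)]
    congr 1
    simp only [gaussianPDFReal, NNReal.coe_one, mul_one, sub_zero]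
    have h2 : (√(2 * Real.pi))⁻¹ * (√(2 * Real.pi))⁻¹ = (2 * Real.pi)⁻¹ := by
      rw [← mul_inv, Real.mul_self_sqrt (by positivity)]
    rw [← h2]
    have h3 : Real.exp (-r ^ 2 / 2) =
        Real.exp (-(r * Real.cos θ) ^ 2 / 2) * Real.exp (-(r * Real.sin θ) ^ 2 / 2) := by
      rw [← Real.exp_add]
      congr 1
      have := Real.sin_sq_add_cos_sq θ
      linear_combination (r ^ 2 / 2) * this
    rw [h3]
    ring
  · rw [Set.indicator_of_notMem (fun h => hc (hmem.1 h)), Set.indicator_of_notMem hc, mul_zero]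

/-- The radial integral need not be evaluated: the whole plane is a cone of mass `1`, which forces
it to be `1 / (2π)`. -/
theorem gaussian_prod_cone_eq_div {A : Set (ℝ × ℝ)} (hA : MeasurableSet A) {Θ : Set ℝ}
    (hΘ : MeasurableSet Θ)
    (h : ∀ r > 0, ∀ θ ∈ Set.Ioo (-Real.pi) Real.pi,
      ((r * Real.cos θ, r * Real.sin θ) ∈ A ↔ θ ∈ Θ)) :
    ((gaussianReal 0 1).prod (gaussianReal 0 1)).real A =
      volume.real (Θ ∩ Set.Ioo (-Real.pi) Real.pi) / (2 * Real.pi) := by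
  have h1 := gaussian_prod_cone (A := Set.univ) MeasurableSet.univ (Θ := Set.univ)
    MeasurableSet.univ (by simp)
  have h2 := gaussian_prod_cone hA hΘ h
  set c := ∫⁻ r in Set.Ioi (0 : ℝ), ENNReal.ofReal r * ENNReal.ofReal
        ((2 * Real.pi)⁻¹ * Real.exp (-r ^ 2 / 2))
  have h1' := congrArg ENNReal.toReal h1
  have h2' := congrArg ENNReal.toReal h2
  rw [ENNReal.toReal_mul] at h1' h2'
  simp only [measure_univ, ENNReal.toReal_one, Set.univ_inter, Real.volume_Ioo] at h1'
  rw [ENNReal.toReal_ofReal (by linarith [Real.pi_pos])] at h1'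
  have hpi := Real.pi_pos
  rw [Measure.real, h2', Measure.real, eq_div_iff (by positivity)]
  linear_combination (-(volume (Θ ∩ Set.Ioo (-Real.pi) Real.pi)).toReal) * h1'

/-! ### Angles on which two half-planes agree -/

theorem zero_le_cos_iff {θ : ℝ} (h₁ : -Real.pi < θ) (h₂ : θ < Real.pi) :
    0 ≤ Real.cos θ ↔ -(Real.pi / 2) ≤ θ ∧ θ ≤ Real.pi / 2 := by
  constructor
  · intro h
    constructor
    · by_contra! hlt
      have := Real.cos_neg_of_pi_div_two_lt_of_lt (x := -θ) (by linarith) (by linarith)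
      rw [Real.cos_neg] at this
      linarith
    · by_contra! hlt
      have := Real.cos_neg_of_pi_div_two_lt_of_lt hlt (by linarith)
      linarith
  · exact fun h => Real.cos_nonneg_of_mem_Icc h

/-- The directions at which two half-planes at angle `φ` agree. -/
theorem volume_agreement_angles {φ : ℝ} (h₀ : 0 ≤ φ) (hπ : φ ≤ Real.pi) :
    volume.real ({θ | 0 ≤ Real.cos θ ↔ 0 ≤ Real.cos (θ - φ)} ∩ Set.Ioo (-Real.pi) Real.pi) =
      2 * (Real.pi - φ) := by
  have hpi := Real.pi_pos
  -- The first interval is where both cosines are nonnegative, the other two where both are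
  -- negative. The maximum, and the last interval becoming empty for `φ ≥ π / 2`, cover acute and
  -- obtuse `φ` together.
  have hset : ({θ | 0 ≤ Real.cos θ ↔ 0 ≤ Real.cos (θ - φ)} ∩ Set.Ioo (-Real.pi) Real.pi : Set ℝ) =ᵐ[volume]
      (Set.Icc (φ - Real.pi / 2) (Real.pi / 2) ∪
        (Set.Ioo (max (-Real.pi) (φ - 3 * Real.pi / 2)) (-(Real.pi / 2)) ∪
          Set.Ioo (φ + Real.pi / 2) Real.pi) : Set ℝ) := by
    have hne : ∀ᵐ θ : ℝ, θ ≠ φ - Real.pi ∧ θ ≠ φ - 3 * Real.pi / 2 ∧ θ ≠ -(Real.pi / 2) := by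
      refine (Measure.ae_ne _ _).and ((Measure.ae_ne _ _).and (Measure.ae_ne _ _))
    filter_upwards [hne] with θ ⟨hne₁, hne₂, hne₃⟩
    apply propext
    change ((0 ≤ Real.cos θ ↔ 0 ≤ Real.cos (θ - φ)) ∧ (-Real.pi < θ ∧ θ < Real.pi)) ↔
      ((φ - Real.pi / 2 ≤ θ ∧ θ ≤ Real.pi / 2) ∨
        ((max (-Real.pi) (φ - 3 * Real.pi / 2) < θ ∧ θ < -(Real.pi / 2)) ∨
          (φ + Real.pi / 2 < θ ∧ θ < Real.pi)))
    rw [max_lt_iff]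
    by_cases hθ : -Real.pi < θ ∧ θ < Real.pi
    · obtain ⟨hθ₁, hθ₂⟩ := hθ
      rw [zero_le_cos_iff hθ₁ hθ₂]
      rcases lt_or_gt_of_ne hne₁ with hlt | hgt
      -- Here `θ - φ < -π`, so a full turn brings the angle back into the range of the criterion.
      · rw [← Real.cos_add_two_pi (θ - φ), zero_le_cos_iff (by linarith) (by linarith)]
        rcases lt_or_gt_of_ne hne₂ with h2 | h2 <;> rcases lt_or_gt_of_ne hne₃ with h3 | h3 <;> grind
      · rw [zero_le_cos_iff (by linarith) (by linarith)]
        rcases lt_or_gt_of_ne hne₂ with h2 | h2 <;> rcases lt_or_gt_of_ne hne₃ with h3 | h3 <;> grind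
    · constructor
      · exact fun h => absurd h.2 hθ
      · intro h
        exfalso
        apply hθ
        grind
  have hfin (s t : ℝ) : volume (Set.Ioo s t) ≠ ⊤ := measure_Ioo_lt_top.ne
  rw [measureReal_congr hset,
    measureReal_union _ _ measure_Icc_lt_top.ne (measure_union_ne_top (hfin _ _) (hfin _ _)),
    measureReal_union _ _ (hfin _ _) (hfin _ _)]
  · simp only [Measure.real, Real.volume_Icc, Real.volume_Ioo, ENNReal.toReal_ofReal']
    grind
  · rw [Set.disjoint_left]
    intro θ h1 h2
    simp only [Set.mem_Ioo] at h1 h2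
    linarith [h1.2, h2.1]
  · exact measurableSet_Ioo
  · rw [Set.disjoint_left]
    intro θ h1 h2
    simp only [Set.mem_Ioo, Set.mem_union, Set.mem_Icc, max_lt_iff] at h1 h2
    grind
  · exact measurableSet_Ioo.union measurableSet_Ioo

/-! ### Collision probability for arbitrary vectors -/

theorem measurable_srp {k : ℕ} (x : Vec k) : Measurable fun a : Vec k => srp a x := by
  unfold srp
  refine measurable_to_bool ?_
  have : (fun a : Vec k => decide (0 ≤ ⟪a, x⟫_ℝ)) ⁻¹' {true} = {a | 0 ≤ ⟪a, x⟫_ℝ} := by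
    ext; simp
  rw [this]
  exact measurableSet_le measurable_const (by fun_prop)

theorem srp_smul {k : ℕ} (a x : Vec k) {r : ℝ} (hr : 0 < r) : srp a (r • x) = srp a x := by
  unfold srp
  rw [inner_smul_right]
  simp [mul_nonneg_iff_of_pos_left hr]

/-- In the planar model the two products at polar angle `θ` are positive multiples of `cos θ` and
`cos (θ - φ)`, so agreement is a cone of total angle `2 (π - φ)`. -/
theorem stdGaussian_srp_eq_of_norm_one {k : ℕ} {x y : Vec k} (hx : ‖x‖ = 1) (hy : ‖y‖ = 1) :
    (stdGaussian (Vec k)).real {a | srp a x = srp a y} = srpProb (Real.arccos ⟪x, y⟫_ℝ) := by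
  have hle : |⟪x, y⟫_ℝ| ≤ 1 := by
    simpa [hx, hy] using abs_real_inner_le_norm x y
  have hcos := Real.cos_arccos (abs_le.1 hle).1 (abs_le.1 hle).2
  set φ := Real.arccos ⟪x, y⟫_ℝ
  set A : Set (ℝ × ℝ) := {z | 0 ≤ z.1 ↔ 0 ≤ z.2}
  have hm₁ : MeasurableSet {z : ℝ × ℝ | 0 ≤ z.1} := measurableSet_le measurable_const measurable_fst
  have hm₂ : MeasurableSet {z : ℝ × ℝ | 0 ≤ z.2} := measurableSet_le measurable_const measurable_snd
  have hA : MeasurableSet A := by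
    exact hm₁.iff hm₂
  have hpre : {a | srp a x = srp a y} = (fun a : Vec k => (⟪a, x⟫_ℝ, ⟪a, y⟫_ℝ)) ⁻¹' A := by
    ext a
    simp [srp, A]
  rw [hpre, ← map_measureReal_apply (by fun_prop) hA, map_inner_pair hx hy hcos.symm,
    map_measureReal_apply (by fun_prop) hA]
  have hΘ : MeasurableSet {θ : ℝ | 0 ≤ Real.cos θ ↔ 0 ≤ Real.cos (θ - φ)} := by
    refine MeasurableSet.iff ?_ ?_
    · exact measurableSet_le measurable_const (by fun_prop)
    · exact measurableSet_le measurable_const (by fun_prop)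
  rw [gaussian_prod_cone_eq_div (Θ := {θ | 0 ≤ Real.cos θ ↔ 0 ≤ Real.cos (θ - φ)})
    (hA.preimage (by fun_prop)) hΘ, volume_agreement_angles (Real.arccos_nonneg _)
      (Real.arccos_le_pi _), srpProb]
  · field_simp
    rfl
  · intro r hr θ _
    have : Real.cos φ * (r * Real.cos θ) + Real.sin φ * (r * Real.sin θ) = r * Real.cos (θ - φ) := by
      rw [Real.cos_sub]; ring
    simp only [Set.mem_preimage, A, Set.mem_ofPred_eq, this, mul_nonneg_iff_of_pos_left hr]

/-- Sign random projection separates two nonzero vectors with probability proportional to their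
angle. -/
theorem gaussian_srp_eq {k : ℕ} {x y : Vec k} (hx : x ≠ 0) (hy : y ≠ 0) :
    (Measure.pi fun _ : Fin k => gaussianReal 0 1).real
      {g | srp (WithLp.toLp 2 g) x = srp (WithLp.toLp 2 g) y} =
      srpProb (Real.arccos (⟪x, y⟫_ℝ / (‖x‖ * ‖y‖))) := by
  have hx' := norm_pos_iff.2 hx
  have hy' := norm_pos_iff.2 hy
  have h1 := stdGaussian_srp_eq_of_norm_one (x := ‖x‖⁻¹ • x) (y := ‖y‖⁻¹ • y)
    (by rw [norm_smul, norm_inv, norm_norm, inv_mul_cancel₀ hx'.ne'])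
    (by rw [norm_smul, norm_inv, norm_norm, inv_mul_cancel₀ hy'.ne'])
  simp only [srp_smul _ _ (inv_pos.2 hx'), srp_smul _ _ (inv_pos.2 hy')] at h1
  rw [inner_smul_left, inner_smul_right, ← map_pi_eq_stdGaussian, map_measureReal_apply] at h1
  · rw [← Set.preimage_ofPred_eq (p := fun a : Vec k => srp a x = srp a y), h1]
    congr 2
    simp only [conj_trivial]
    field_simp
  · fun_prop
  · exact measurableSet_eq_fun (measurable_srp x) (measurable_srp y)

/-! ### Collisions in independent hash tables -/

section Tables

variable {X : Type*} [MeasurableSpace X] (γ : Measure X) [IsProbabilityMeasure γ]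

theorem pi_real_univ_pi (m : ℕ) (H : Set X) :
    (Measure.pi fun _ : Fin m => γ).real (Set.univ.pi fun _ => H) = γ.real H ^ m := by
  simp [Measure.real, Measure.pi_pi]

/-- The probability that an item collides in none of the tables. -/
theorem no_collision_prob_le {K m : ℕ} {H : Set X} (hH : MeasurableSet H) {p : ℝ} (hp₀ : 0 ≤ p)
    (hp : p ≤ γ.real H) :
    (Measure.pi fun _ : Fin K => Measure.pi fun _ : Fin m => γ).real
      {g | ∀ k, ¬ ∀ i, g k i ∈ H} ≤ (1 - p ^ m) ^ K := by
  have hset : {g : Fin K → Fin m → X | ∀ k, ¬ ∀ i, g k i ∈ H} =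
      Set.univ.pi fun _ => (Set.univ.pi fun _ => H)ᶜ := by
    ext g
    simp [Set.mem_pi]
  rw [hset, pi_real_univ_pi, probReal_compl_eq_one_sub (MeasurableSet.univ_pi fun _ => hH),
    pi_real_univ_pi]
  have h1 : γ.real H ^ m ≤ 1 := pow_le_one₀ measureReal_nonneg measureReal_le_one
  gcongr

open Classical in
/-- The number of items of a list that collide in a table. -/
def collisions {α : Type*} {m : ℕ} (H : α → Set X) (l : List α) (g : Fin m → X) : ℕ :=
  l.countP fun p => decide (∀ i, g i ∈ H p)

theorem measurable_collisions {α : Type*} {m : ℕ} {H : α → Set X} (hH : ∀ p, MeasurableSet (H p))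
    (l : List α) : Measurable (collisions (m := m) H l) := by
  classical
  induction l with
  | nil => exact measurable_const
  | cons p l ih =>
    have : collisions (m := m) H (p :: l) = fun g => collisions H l g +
        (Set.univ.pi fun _ => H p).indicator (fun _ => 1) g := by
      ext g
      simp [collisions, List.countP_cons, Set.indicator_apply]
    rw [this]
    exact ih.add (measurable_const.indicator (MeasurableSet.univ_pi fun _ => hH p))

/-- Linearity of expectation: by independence of the `m` functions, each item contributes at most `q
^ m`. Independence between items is not needed. -/
theorem lintegral_collisions_le {α : Type*} {m : ℕ} {H : α → Set X}
    (hH : ∀ p, MeasurableSet (H p)) {q : ℝ} (l : List α) (hq : ∀ p ∈ l, γ.real (H p) ≤ q) :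
    ∫⁻ g, (collisions H l g : ENNReal) ∂(Measure.pi fun _ : Fin m => γ) ≤
      ENNReal.ofReal (l.length * q ^ m) := by
  classical
  induction l with
  | nil => simp [collisions]
  | cons p l ih =>
    have hq₀ : 0 ≤ q := measureReal_nonneg.trans (hq p (by simp))
    have hmeas : MeasurableSet (Set.univ.pi fun _ : Fin m => H p) :=
      MeasurableSet.univ_pi fun _ => hH p
    have : (fun g : Fin m → X => (collisions H (p :: l) g : ENNReal)) =
        fun g => (collisions H l g : ENNReal) +
          (Set.univ.pi fun _ : Fin m => H p).indicator (fun _ => 1) g := by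
      ext g
      simp [collisions, List.countP_cons, Set.indicator_apply]
    rw [this, lintegral_add_right _ (measurable_const.indicator hmeas), lintegral_indicator hmeas,
      setLIntegral_one, List.length_cons, Nat.cast_add_one, add_mul, one_mul,
      ENNReal.ofReal_add (by positivity) (by positivity)]
    refine add_le_add (ih fun p' hp' => hq p' (List.mem_cons_of_mem _ hp')) ?_
    rw [← ofReal_measureReal (measure_ne_top _ _), pi_real_univ_pi]
    exact ENNReal.ofReal_le_ofReal (pow_le_pow_left₀ measureReal_nonneg (hq p (by simp)) m)

/-- Markov's inequality for the number of collisions in all tables. -/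
theorem many_collisions_prob_le {α : Type*} {K m B : ℕ} {H : α → Set X}
    (hH : ∀ p, MeasurableSet (H p)) {q : ℝ} (l : List α) (hq : ∀ p ∈ l, γ.real (H p) ≤ q)
    (hlq : l.length * q ^ m ≤ 1) (hB : 0 < B) :
    (Measure.pi fun _ : Fin K => Measure.pi fun _ : Fin m => γ).real
      {g | B ≤ ∑ k, collisions H l (g k)} ≤ K / B := by
  set μ := Measure.pi fun _ : Fin K => Measure.pi fun _ : Fin m => γ
  have hmeas : ∀ k : Fin K, Measurable fun g : Fin K → Fin m → X =>
      (collisions H l (g k) : ENNReal) := fun k =>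
    (measurable_of_countable _ : Measurable (Nat.cast : ℕ → ENNReal)).comp
      ((measurable_collisions hH l).comp (measurable_pi_apply k))
  have hint : ∫⁻ g, ∑ k, (collisions H l (g k) : ENNReal) ∂μ ≤ K := by
    rw [lintegral_finsetSum _ fun k _ => hmeas k]
    calc ∑ k : Fin K, ∫⁻ g, (collisions H l (g k) : ENNReal) ∂μ
        ≤ ∑ k : Fin K, (1 : ENNReal) := by
          refine Finset.sum_le_sum fun k _ => ?_
          -- Each table has the law of a single table, so its expected count is at most `1`.
          have h := (measurePreserving_eval (fun _ : Fin K => Measure.pi fun _ : Fin m => γ)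
            k).lintegral_comp (f := fun g => (collisions H l g : ENNReal))
            ((measurable_of_countable _ : Measurable (Nat.cast : ℕ → ENNReal)).comp
              (measurable_collisions hH l))
          simp only [Function.eval] at h
          rw [h]
          refine (lintegral_collisions_le γ hH l hq).trans ?_
          exact ENNReal.ofReal_le_one.2 hlq
      _ = K := by simp
  have hmarkov := mul_meas_ge_le_lintegral (μ := μ)
    (Finset.measurable_fun_sum Finset.univ fun k _ => hmeas k) (B : ENNReal)
  have hset : {g : Fin K → Fin m → X | (B : ENNReal) ≤ ∑ k, (collisions H l (g k) : ENNReal)} =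
      {g | B ≤ ∑ k, collisions H l (g k)} := by
    ext g
    simp only [Set.mem_ofPred_eq]
    exact_mod_cast Iff.rfl
  rw [hset] at hmarkov
  have h := ENNReal.toReal_mono (by simp) (hmarkov.trans hint)
  rw [ENNReal.toReal_mul] at h
  simp only [ENNReal.toReal_natCast] at h
  rw [le_div_iff₀ (by exact_mod_cast hB), mul_comm]
  exact h

end Tables

/-! ### Collisions of transformed items and users -/

/-- The hash functions under which an item of the partition `S` collides with the user `u`. -/
def collisionSet {d : ℕ} (S : List (Vec d)) (u p : Vec d) : Set (Fin (d + 1) → ℝ) :=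
  {g | srp (WithLp.toLp 2 g) (itemMap (centroid S) (radius S) p) =
    srp (WithLp.toLp 2 g) (userMap (radius S) u)}

theorem measurableSet_collisionSet {d : ℕ} (S : List (Vec d)) (u p : Vec d) :
    MeasurableSet (collisionSet S u p) :=
  measurableSet_eq_fun ((measurable_srp _).comp (by fun_prop)) ((measurable_srp _).comp (by fun_prop))

theorem le_maxOf {l : List ℝ} {x : ℝ} (hx : x ∈ l) : x ≤ maxOf l := by
  induction l with
  | nil => simp at hx
  | cons y l ih =>
    rcases List.mem_cons.1 hx with rfl | h
    · exact le_max_left _ _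
    · exact (ih h).trans (le_max_right _ _)

theorem maxOf_nonneg (l : List ℝ) : 0 ≤ maxOf l := by
  cases l with
  | nil => exact le_rfl
  | cons x l => exact (maxOf_nonneg l).trans (le_max_right _ _)

theorem norm_sub_centroid_le_radius {d : ℕ} {S : List (Vec d)} {p : Vec d} (hp : p ∈ S) :
    ‖p - centroid S‖ ≤ radius S :=
  le_maxOf (List.mem_map.2 ⟨p, hp, rfl⟩)

/-- The padding of the item meets the `0` of the user and drops out. -/
theorem inner_itemMap_userMap {d : ℕ} (c : Vec d) (R : ℝ) (p u : Vec d) :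
    ⟪itemMap c R p, userMap R u⟫_ℝ = R / ‖u‖ * ⟪p - c, u⟫_ℝ := by
  simp only [itemMap, userMap, PiLp.inner_apply, Fin.sum_univ_castSucc, Fin.snoc_castSucc,
    Fin.snoc_last, Finset.mul_sum]
  simp
  refine Finset.sum_congr rfl fun i _ => by ring

/-- The last coordinate is chosen to complete the squared norm to `R ^ 2`; the hypothesis makes the
radicand nonnegative. -/
theorem norm_itemMap {d : ℕ} {c : Vec d} {R : ℝ} {p : Vec d} (h : ‖p - c‖ ≤ R) :
    ‖itemMap c R p‖ = R := by
  have h0 := norm_nonneg (p - c)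
  have hsq : ‖itemMap c R p‖ ^ 2 = R ^ 2 := by
    rw [EuclideanSpace.norm_sq_eq, Fin.sum_univ_castSucc]
    simp only [itemMap, Fin.snoc_castSucc, Fin.snoc_last]
    have h1 : ∑ i, ‖p i - c i‖ ^ 2 = ‖p - c‖ ^ 2 := by
      rw [EuclideanSpace.norm_sq_eq]; simp
    rw [h1, Real.norm_eq_abs, sq_abs, Real.sq_sqrt (by nlinarith)]
    ring
  exact (pow_left_inj₀ (norm_nonneg _) (h0.trans h) two_ne_zero).1 hsq

theorem norm_userMap {d : ℕ} {R : ℝ} (hR : 0 ≤ R) {u : Vec d} (hu : u ≠ 0) :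
    ‖userMap R u‖ = R := by
  have hu' := norm_pos_iff.2 hu
  have hsq : ‖userMap R u‖ ^ 2 = R ^ 2 := by
    rw [EuclideanSpace.norm_sq_eq, Fin.sum_univ_castSucc]
    simp only [userMap, Fin.snoc_castSucc, Fin.snoc_last, norm_mul, mul_pow]
    rw [← Finset.mul_sum, ← EuclideanSpace.norm_sq_eq]
    rw [norm_div, norm_norm, Real.norm_eq_abs, norm_zero, div_pow, sq_abs]
    field_simp
    ring
  exact (pow_left_inj₀ (norm_nonneg _) hR two_ne_zero).1 hsq

theorem gaussian_collisionSet {d : ℕ} {S : List (Vec d)} (hR : 0 < radius S) {u : Vec d}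
    (hu : u ≠ 0) {p : Vec d} (hp : p ∈ S) :
    (Measure.pi fun _ : Fin (d + 1) => gaussianReal 0 1).real (collisionSet S u p) =
      srpProb (Real.arccos (⟪p - centroid S, u⟫_ℝ / (radius S * ‖u‖))) := by
  have h1 := norm_itemMap (norm_sub_centroid_le_radius hp)
  have h2 := norm_userMap hR.le hu
  have h3 := norm_pos_iff.2 hu
  rw [collisionSet, gaussian_srp_eq (norm_pos_iff.1 (hR.trans_eq h1.symm))
    (norm_pos_iff.1 (hR.trans_eq h2.symm)), h1, h2,
    inner_itemMap_userMap]
  congr 2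
  field_simp

/-- Both transformed vectors vanish, so the degenerate partition has certain collisions and needs no
angle hypothesis. -/
theorem collisionSet_eq_univ_of_radius_eq_zero {d : ℕ} {S : List (Vec d)} (hR : radius S = 0)
    (u : Vec d) {p : Vec d} (hp : p ∈ S) : collisionSet S u p = Set.univ := by
  have h1 : itemMap (centroid S) (radius S) p = 0 :=
    norm_eq_zero.1 ((norm_itemMap (norm_sub_centroid_le_radius hp)).trans hR)
  have h2 : userMap (radius S) u = 0 := by
    ext i
    refine Fin.lastCases ?_ (fun i => ?_) i <;> simp [userMap, hR]
  simp [collisionSet, h1, h2]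

theorem eq_centroid_of_radius_eq_zero {d : ℕ} {S : List (Vec d)} (hR : radius S = 0)
    {p : Vec d} (hp : p ∈ S) : p = centroid S := by
  have := norm_sub_centroid_le_radius hp
  rw [hR] at this
  exact sub_eq_zero.1 (norm_le_zero_iff.1 this)

/-- Carries the bound `p₂` from the threshold to every item below it. No range condition is needed,
as `Real.arccos` is constant outside `[-1, 1]`. -/
theorem srpProb_arccos_mono {x y : ℝ} (h : x ≤ y) :
    srpProb (Real.arccos x) ≤ srpProb (Real.arccos y) := by
  have := Real.arccos_le_arccos h
  have hpi := Real.pi_pos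
  unfold srpProb
  gcongr

/-! ### Step counting of composed computations -/

@[simp] theorem Cost.val_pure {α : Type} (a : α) : (pure a : Cost α).val = a := rfl

@[simp] theorem Cost.steps_pure {α : Type} (a : α) : (pure a : Cost α).steps = 0 := rfl

@[simp] theorem Cost.val_bind {α β : Type} (x : Cost α) (f : α → Cost β) :
    (x >>= f).val = (f x.val).val := rfl

@[simp] theorem Cost.steps_bind {α β : Type} (x : Cost α) (f : α → Cost β) :
    (x >>= f).steps = x.steps + (f x.val).steps := rfl

variable {d : ℕ}

theorem keyC_val {k : ℕ} (l : List (Vec k)) (x : Vec k) :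
    (keyC l x).val = l.map fun a => srp a x := by
  induction l with
  | nil => rfl
  | cons a l ih => simp [keyC, ih, srpC]

theorem keyC_steps {k : ℕ} (l : List (Vec k)) (x : Vec k) :
    (keyC l x).steps = l.length * (2 * k + 1) := by
  induction l with
  | nil => simp [keyC]
  | cons a l ih => simp [keyC, ih, srpC]; ring

/-- The unspent budget acts as a potential. Stated as an equation, it telescopes when the budget is
handed from table to table. -/
theorem scanC_steps (u : Vec d) (B : ℕ) (l : List (Vec d)) (best : Option (ℝ × Vec d)) :
    (scanC u B l best).steps + (scanC u B l best).val.1 * (2 * d + 1) = B * (2 * d + 1) := by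
  induction l generalizing B best with
  | nil => simp [scanC]
  | cons p l ih =>
    cases B with
    | zero => simp [scanC]
    | succ B =>
      have := ih B (improveC best ⟪p, u⟫_ℝ p).val
      simp only [scanC, dotC, Cost.steps_bind, Cost.val_bind]
      simp only [improveC] at this ⊢
      linarith

/-- Hashing is paid once per table, scanning once per search, because all tables share the budget
`B`. -/
theorem simHashC_steps_le (u : Vec d) (x : Vec (d + 1)) {m : ℕ} (B : ℕ) (Ts : List (Table d))
    (hTs : ∀ T ∈ Ts, T.funs.length = m) (best : Option (ℝ × Vec d)) :
    (simHashC u x B Ts best).steps ≤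
      Ts.length * (m * (2 * (d + 1) + 1) + (m + 1)) + B * (2 * d + 1) := by
  induction Ts generalizing B best with
  | nil => simp [simHashC]
  | cons T Ts ih =>
    have hm : T.funs.length = m := hTs T (by simp)
    have hscan := scanC_steps u B (T.bucket (keyC T.funs x).val) best
    have hrec := ih (scanC u B (T.bucket (keyC T.funs x).val) best).val.1
      (fun T' hT' => hTs T' (List.mem_cons_of_mem _ hT'))
      (scanC u B (T.bucket (keyC T.funs x).val) best).val.2
    have hlen : (keyC T.funs x).val.length = m := by rw [keyC_val, List.length_map, hm]
    simp only [simHashC, Table.lookupC, Cost.steps_bind, keyC_steps, hm, hlen,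
      List.length_cons]
    nlinarith

theorem searchC_steps_le (u : Vec d) (ν : ℝ) (B : ℕ) {K m : ℕ} (I : List (Block d))
    (hI : ∀ S ∈ I, S.tables.length = K ∧ ∀ T ∈ S.tables, T.funs.length = m)
    (best : Option (ℝ × Vec d)) :
    (searchC u ν B I best).steps ≤ I.length *
      (d + 4 + (K * (m * (2 * (d + 1) + 1) + (m + 1)) + B * (2 * d + 1))) := by
  induction I generalizing best with
  | nil => simp [searchC]
  | cons S I ih =>
    obtain ⟨hK, hm⟩ := hI S (by simp)
    simp only [searchC, mulC, Cost.steps_bind, List.length_cons, Nat.add_mul, one_mul]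
    have h1 : (exceedsC best (S.maxNorm * ν)).steps = 1 := rfl
    rw [h1]
    split_ifs
    · simp only [Cost.steps_pure]
      have := Nat.zero_le (I.length *
        (d + 4 + (K * (m * (2 * (d + 1) + 1) + (m + 1)) + B * (2 * d + 1))))
      omega
    · simp only [Cost.steps_bind, userMapC]
      have hs := simHashC_steps_le u (userMap S.radius u) B S.tables hm best
      have hr := ih (fun S' hS' => hI S' (List.mem_cons_of_mem _ hS'))
        (simHashC u (userMap S.radius u) B S.tables best).val
      rw [hK] at hs
      omega

theorem query_steps_le (u : Vec d) (B : ℕ) {K m : ℕ} (I : List (Block d))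
    (hI : ∀ S ∈ I, S.tables.length = K ∧ ∀ T ∈ S.tables, T.funs.length = m) :
    (query B I u).steps ≤ 2 * d + 1 + I.length *
      (d + 4 + (K * (m * (2 * (d + 1) + 1) + (m + 1)) + B * (2 * d + 1))) := by
  have := searchC_steps_le u ‖u‖ B I hI none
  simp only [query, normC, Cost.steps_bind, Cost.steps_pure]
  omega

/-! ### The result of a query -/

/-- The stored item is an item of `P`, stored with its inner product with `u`. -/
def Sound (P : Finset (Vec d)) (u : Vec d) (best : Option (ℝ × Vec d)) : Prop :=
  ∀ r ∈ best, r.2 ∈ P ∧ r.1 = ⟪r.2, u⟫_ℝ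

/-- An item with inner product at least `τ` is stored. -/
def Reaches (τ : ℝ) (best : Option (ℝ × Vec d)) : Prop := ∃ r ∈ best, τ ≤ r.1

theorem Sound.improveC {P : Finset (Vec d)} {u : Vec d} {best : Option (ℝ × Vec d)}
    (h : Sound P u best) {p : Vec d} (hp : p ∈ P) : Sound P u (improveC best ⟪p, u⟫_ℝ p).val := by
  intro r hr
  rcases best with _ | ⟨φ, q⟩
  · simp only [SAALSH.improveC, Option.mem_some_iff] at hr
    subst hr
    exact ⟨hp, rfl⟩
  · simp only [SAALSH.improveC] at hr
    split_ifs at hr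
    · rw [Option.mem_some_iff] at hr
      subst hr
      exact ⟨hp, rfl⟩
    · exact h r hr

theorem Reaches.improveC {τ : ℝ} {best : Option (ℝ × Vec d)} (h : Reaches τ best) (s : ℝ)
    (p : Vec d) : Reaches τ (improveC best s p).val := by
  obtain ⟨⟨φ, q⟩, hr, hτ⟩ := h
  rw [Option.mem_def] at hr
  subst hr
  simp only [SAALSH.improveC]
  split_ifs with hs
  · exact ⟨_, rfl, hτ.trans hs.le⟩
  · exact ⟨_, rfl, hτ⟩

theorem reaches_improveC {τ s : ℝ} (h : τ ≤ s) (best : Option (ℝ × Vec d)) (p : Vec d) :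
    Reaches τ (improveC best s p).val := by
  rcases best with _ | ⟨φ, q⟩
  · exact ⟨_, rfl, h⟩
  · simp only [improveC]
    split_ifs with hs
    · exact ⟨_, rfl, h⟩
    · exact ⟨_, rfl, h.trans (not_lt.1 hs)⟩

theorem scanC_cons_val (u : Vec d) (B : ℕ) (p : Vec d) (l : List (Vec d))
    (best : Option (ℝ × Vec d)) :
    (scanC u (B + 1) (p :: l) best).val = (scanC u B l (improveC best ⟪p, u⟫_ℝ p).val).val := rfl

theorem Sound.scanC {P : Finset (Vec d)} {u : Vec d} {l : List (Vec d)} (hl : ∀ p ∈ l, p ∈ P)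
    (B : ℕ) {best : Option (ℝ × Vec d)} (h : Sound P u best) :
    Sound P u (scanC u B l best).val.2 := by
  induction l generalizing B best with
  | nil => simpa [SAALSH.scanC] using h
  | cons p l ih =>
    cases B with
    | zero => simpa [SAALSH.scanC] using h
    | succ B =>
      rw [scanC_cons_val]
      exact ih (fun q hq => hl q (List.mem_cons_of_mem _ hq)) B (h.improveC (hl p (by simp)))

theorem Reaches.scanC {τ : ℝ} (u : Vec d) (B : ℕ) (l : List (Vec d))
    {best : Option (ℝ × Vec d)} (h : Reaches τ best) : Reaches τ (scanC u B l best).val.2 := by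
  induction l generalizing B best with
  | nil => simpa [SAALSH.scanC] using h
  | cons p l ih =>
    cases B with
    | zero => simpa [SAALSH.scanC] using h
    | succ B =>
      rw [scanC_cons_val]
      exact ih B (h.improveC _ _)

open Classical in
/-- The number of items of a list whose inner product with `u` is below `τ`. -/
def farCount (u : Vec d) (τ : ℝ) (l : List (Vec d)) : ℕ := l.countP fun p => decide (⟪p, u⟫_ℝ < τ)

theorem farCount_cons_of_lt {u : Vec d} {τ : ℝ} {p : Vec d} (h : ⟪p, u⟫_ℝ < τ)
    (l : List (Vec d)) : farCount u τ (p :: l) = farCount u τ l + 1 := by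
  simp [farCount, h]

/-- A scan that misses `τ` has spent its budget on far items only. -/
theorem scanC_reaches_or_le (u : Vec d) (τ : ℝ) (B : ℕ) (l : List (Vec d))
    (best : Option (ℝ × Vec d)) :
    Reaches τ (scanC u B l best).val.2 ∨ B ≤ (scanC u B l best).val.1 + farCount u τ l := by
  induction l generalizing B best with
  | nil => right; simp [scanC]
  | cons p l ih =>
    cases B with
    | zero => right; simp
    | succ B =>
      rw [scanC_cons_val]
      by_cases hp : ⟪p, u⟫_ℝ < τ
      · rw [farCount_cons_of_lt hp]
        exact (ih B _).imp id fun h => by omega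
      · exact Or.inl (Reaches.scanC _ _ _ (reaches_improveC (not_lt.1 hp) _ _))

/-- Only far items can precede the first item reaching `τ`, and they are too few to exhaust the
budget. -/
theorem scanC_reaches (u : Vec d) {τ : ℝ} {B : ℕ} {l : List (Vec d)}
    (best : Option (ℝ × Vec d)) (hfar : farCount u τ l < B) (hnear : ∃ p ∈ l, τ ≤ ⟪p, u⟫_ℝ) :
    Reaches τ (scanC u B l best).val.2 := by
  induction l generalizing B best with
  | nil => simp at hnear
  | cons p l ih =>
    cases B with
    | zero => omega
    | succ B =>
      rw [scanC_cons_val]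
      by_cases hp : ⟪p, u⟫_ℝ < τ
      · rw [farCount_cons_of_lt hp] at hfar
        refine ih _ (by omega) ?_
        obtain ⟨q, hq, hτ⟩ := hnear
        rcases List.mem_cons.1 hq with rfl | hq
        · exact absurd hτ (not_le.2 hp)
        · exact ⟨q, hq, hτ⟩
      · exact Reaches.scanC _ _ _ (reaches_improveC (not_lt.1 hp) _ _)

/-- The bucket of a transformed user in a table. -/
def Table.candidates (T : Table d) (x : Vec (d + 1)) : List (Vec d) :=
  T.bucket (T.funs.map fun a => srp a x)

theorem simHashC_cons_val (u : Vec d) (x : Vec (d + 1)) (B : ℕ) (T : Table d) (Ts : List (Table d))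
    (best : Option (ℝ × Vec d)) :
    (simHashC u x B (T :: Ts) best).val =
      (simHashC u x (scanC u B (T.candidates x) best).val.1 Ts
        (scanC u B (T.candidates x) best).val.2).val := by
  simp only [simHashC, Cost.val_bind, Table.lookupC, keyC_val, Table.candidates]

theorem Sound.simHashC {P : Finset (Vec d)} {u : Vec d} {x : Vec (d + 1)} {Ts : List (Table d)}
    (hTs : ∀ T ∈ Ts, ∀ p ∈ T.candidates x, p ∈ P) (B : ℕ) {best : Option (ℝ × Vec d)}
    (h : Sound P u best) : Sound P u (simHashC u x B Ts best).val := by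
  induction Ts generalizing B best with
  | nil => simpa [SAALSH.simHashC] using h
  | cons T Ts ih =>
    rw [simHashC_cons_val]
    exact ih (fun T' hT' => hTs T' (List.mem_cons_of_mem _ hT')) _ (h.scanC (hTs T (by simp)) B)

theorem Reaches.simHashC {τ : ℝ} (u : Vec d) (x : Vec (d + 1)) (B : ℕ) (Ts : List (Table d))
    {best : Option (ℝ × Vec d)} (h : Reaches τ best) :
    Reaches τ (simHashC u x B Ts best).val := by
  induction Ts generalizing B best with
  | nil => simpa [SAALSH.simHashC] using h
  | cons T Ts ih =>
    rw [simHashC_cons_val]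
    exact ih _ (h.scanC _ _ _)

/-- If fewer than `B` far items collide with the user, and some other item does, then the search of
a partition finds an item that is not far. -/
theorem simHashC_reaches (u : Vec d) (x : Vec (d + 1)) {τ : ℝ} {B : ℕ} {Ts : List (Table d)}
    (best : Option (ℝ × Vec d))
    (hfar : (Ts.map fun T => farCount u τ (T.candidates x)).sum < B)
    (hnear : ∃ T ∈ Ts, ∃ p ∈ T.candidates x, τ ≤ ⟪p, u⟫_ℝ) :
    Reaches τ (simHashC u x B Ts best).val := by
  induction Ts generalizing B best with
  | nil => simp at hnear
  | cons T Ts ih =>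
    rw [simHashC_cons_val]
    rw [List.map_cons, List.sum_cons] at hfar
    -- A failed scan loses no more budget than the far items of its bucket, so what remains still
    -- exceeds the far items of the remaining tables.
    rcases scanC_reaches_or_le u τ B (T.candidates x) best with h | h
    · exact h.simHashC _ _ _ _
    · obtain ⟨T', hT', hp⟩ := hnear
      rcases List.mem_cons.1 hT' with rfl | hT'
      · exact (scanC_reaches u best (by omega) hp).simHashC _ _ _ _
      · exact ih _ (by omega) ⟨T', hT', hp⟩

theorem Sound.searchC {P : Finset (Vec d)} {u : Vec d} {I : List (Block d)}
    (hI : ∀ S ∈ I, ∀ T ∈ S.tables, ∀ x, ∀ p ∈ T.candidates x, p ∈ P) (ν : ℝ) (B : ℕ)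
    {best : Option (ℝ × Vec d)} (h : Sound P u best) : Sound P u (searchC u ν B I best).val := by
  induction I generalizing best with
  | nil => simpa [SAALSH.searchC] using h
  | cons S I ih =>
    simp only [SAALSH.searchC, Cost.val_bind]
    split_ifs
    · exact h
    · exact ih (fun S' hS' => hI S' (List.mem_cons_of_mem _ hS'))
        (h.simHashC (fun T hT p hp => hI S (by simp) T hT _ p hp) B)

theorem Reaches.searchC {τ : ℝ} (u : Vec d) (ν : ℝ) (B : ℕ) (I : List (Block d))
    {best : Option (ℝ × Vec d)} (h : Reaches τ best) : Reaches τ (searchC u ν B I best).val := by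
  induction I generalizing best with
  | nil => simpa [SAALSH.searchC] using h
  | cons S I ih =>
    simp only [SAALSH.searchC, Cost.val_bind]
    split_ifs
    · exact h
    · exact ih (h.simHashC _ _ _ _)

/-- A stored product is the product of a real item, hence at most `μ`, and the pruning test is
strict. -/
theorem exceedsC_eq_false {P : Finset (Vec d)} {u : Vec d} {best : Option (ℝ × Vec d)}
    (h : Sound P u best) {μ : ℝ} (hμ : ∀ p ∈ P, ⟪p, u⟫_ℝ ≤ μ) : (exceedsC best μ).val = false := by
  rcases best with _ | ⟨φ, q⟩
  · rfl
  · obtain ⟨h1, h2⟩ := h _ rfl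
    simp only at h1 h2
    simp [exceedsC, h2, hμ q h1]

/-- A search that is successful on one partition is successful, unless it is ended before. -/
theorem searchC_reaches {P : Finset (Vec d)} {u : Vec d} {τ ν : ℝ} {B : ℕ}
    {pre post : List (Block d)} {S : Block d}
    (hpre : ∀ Z ∈ pre, ∀ T ∈ Z.tables, ∀ x, ∀ p ∈ T.candidates x, p ∈ P)
    (hbound : ∀ Z ∈ pre, ∀ p ∈ P, ⟪p, u⟫_ℝ ≤ Z.maxNorm * ν)
    (hboundS : ∀ p ∈ P, ⟪p, u⟫_ℝ ≤ S.maxNorm * ν)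
    (hS : ∀ best, Reaches τ (simHashC u (userMap S.radius u) B S.tables best).val)
    {best : Option (ℝ × Vec d)} (hbest : Sound P u best) :
    Reaches τ (searchC u ν B (pre ++ S :: post) best).val := by
  induction pre generalizing best with
  | nil =>
    have hex := exceedsC_eq_false hbest hboundS
    simp only [List.nil_append, searchC, Cost.val_bind, mulC, hex]
    -- `hS` holds for every incoming `best`, and later partitions can only improve the result.
    exact (hS best).searchC _ _ _ _
  | cons Z pre ih =>
    have hex := exceedsC_eq_false hbest (hbound Z (by simp))
    simp only [List.cons_append, searchC, Cost.val_bind, mulC, hex]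
    exact ih (fun Z' hZ' => hpre Z' (List.mem_cons_of_mem _ hZ'))
      (fun Z' hZ' => hbound Z' (List.mem_cons_of_mem _ hZ'))
      (hbest.simHashC (fun T hT p hp => hpre Z (by simp) T hT _ p hp) B)

/-! ### The partitions -/

theorem normBlocks_flatten (b : ℝ) (l : List (Vec d)) : (normBlocks b l).flatten = l := by
  induction l using normBlocks.induct b with
  | case1 => simp [normBlocks]
  | case2 p l ih =>
    rw [normBlocks, List.flatten_cons, ih, List.cons_append, List.takeWhile_append_dropWhile]

theorem ne_nil_of_mem_normBlocks (b : ℝ) (l : List (Vec d)) :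
    ∀ S ∈ normBlocks b l, S ≠ [] := by
  induction l using normBlocks.induct b with
  | case1 => simp [normBlocks]
  | case2 p l ih =>
    intro S hS
    rw [normBlocks, List.mem_cons] at hS
    rcases hS with rfl | hS
    · simp
    · exact ih S hS

variable (b : ℝ) (P : Finset (Vec d))

theorem partitions_flatten_perm : (partitions b P).flatten.Perm P.toList := by
  classical
  rw [partitions, normBlocks_flatten, sortedItems]
  exact List.perm_insertionSort _ _

theorem mem_of_mem_partition {S : List (Vec d)} (hS : S ∈ partitions b P) {p : Vec d}
    (hp : p ∈ S) : p ∈ P :=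
  Finset.mem_toList.1 ((partitions_flatten_perm b P).subset (List.mem_flatten.2 ⟨S, hS, hp⟩))

theorem sum_length_partitions : ((partitions b P).map List.length).sum = P.card := by
  rw [← List.length_flatten, (partitions_flatten_perm b P).length_eq, Finset.length_toList]

theorem length_partition_le {S : List (Vec d)} (hS : S ∈ partitions b P) : S.length ≤ P.card := by
  rw [← sum_length_partitions b P]
  exact List.single_le_sum (by simp) _ (List.mem_map_of_mem hS)

theorem partitions_length_pos (hP : 0 < P.card) : 0 < (partitions b P).length := by
  rw [List.length_pos_iff]
  intro h
  have := sum_length_partitions b P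
  simp [h] at this
  omega

/-- Later partitions hold items of smaller norm. -/
theorem norm_le_of_partitions_lt {i j : Fin (partitions b P).length} (hij : i < j)
    {p q : Vec d} (hp : p ∈ (partitions b P).get i) (hq : q ∈ (partitions b P).get j) :
    ‖q‖ ≤ ‖p‖ := by
  classical
  have hsort : (partitions b P).flatten.Pairwise fun p q : Vec d => ‖q‖ ≤ ‖p‖ := by
    rw [partitions, normBlocks_flatten, sortedItems]
    have : Std.Total fun p q : Vec d => ‖q‖ ≤ ‖p‖ := ⟨fun p q => le_total _ _⟩
    have : IsTrans (Vec d) fun p q : Vec d => ‖q‖ ≤ ‖p‖ := ⟨fun p q r h1 h2 => h2.trans h1⟩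
    exact List.pairwise_insertionSort _ _
  exact List.pairwise_iff_get.1 (List.pairwise_flatten.1 hsort).2 i j hij p hp q hq

/-- The item norms of a partition bound those of all later ones. -/
theorem norm_le_maxNorm {i j : Fin (partitions b P).length} (hij : i ≤ j) {q : Vec d}
    (hq : q ∈ (partitions b P).get j) :
    ‖q‖ ≤ maxOf (((partitions b P).get i).map fun p => ‖p‖) := by
  rcases hij.eq_or_lt with rfl | hlt
  · exact le_maxOf (List.mem_map.2 ⟨q, hq, rfl⟩)
  · obtain ⟨p, hp⟩ := List.exists_mem_of_ne_nil _
      (ne_nil_of_mem_normBlocks b _ _ (List.get_mem (partitions b P) i))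
    exact (norm_le_of_partitions_lt b P hlt hp hq).trans (le_maxOf (List.mem_map.2 ⟨p, hp, rfl⟩))

/-! ### The tables of a partition -/

theorem buildTable_candidates {m : ℕ} (S : List (Vec d)) (g : Fin m → Fin (d + 1) → ℝ)
    (u : Vec d) :
    ∀ p, p ∈ (buildTable S g).candidates (userMap (radius S) u) ↔
      p ∈ S ∧ ∀ i, g i ∈ collisionSet S u p := by
  classical
  intro p
  simp [Table.candidates, Table.bucket, buildTable, List.map_ofFn, List.ofFn_inj, funext_iff,
    collisionSet]

theorem mem_of_mem_buildTable_candidates {m : ℕ} {S : List (Vec d)}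
    {g : Fin m → Fin (d + 1) → ℝ} {x : Vec (d + 1)} {p : Vec d}
    (hp : p ∈ (buildTable S g).candidates x) : p ∈ S := by
  classical
  simp only [Table.candidates, Table.bucket, buildTable, List.mem_map, List.mem_filter] at hp
  obtain ⟨e, ⟨⟨q, hq, rfl⟩, -⟩, rfl⟩ := hp
  exact hq

open Classical in
-- Identifies the far candidates met by the algorithm with the random count to which Markov's
-- inequality applies.
theorem farCount_buildTable_candidates {m : ℕ} (S : List (Vec d)) (g : Fin m → Fin (d + 1) → ℝ)
    (u : Vec d) (τ : ℝ) :
    farCount u τ ((buildTable S g).candidates (userMap (radius S) u)) =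
      collisions (collisionSet S u) (S.filter fun p => decide (⟪p, u⟫_ℝ < τ)) g := by
  simp only [farCount, Table.candidates, Table.bucket, buildTable, collisions, List.filter_map,
    List.countP_map, List.countP_filter]
  refine List.countP_congr fun p _ => ?_
  have hiff : (List.ofFn fun i => srp (WithLp.toLp 2 (g i)) (itemMap (centroid S) (radius S) p)) =
      (List.ofFn fun i => WithLp.toLp 2 (g i)).map (fun a => srp a (userMap (radius S) u)) ↔
      ∀ i, g i ∈ collisionSet S u p := by
    simp [List.map_ofFn, List.ofFn_inj, funext_iff, collisionSet]
  simp only [Function.comp_apply, Bool.and_eq_true, decide_eq_true_eq, hiff, and_comm]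

/-! ### Shape and size of the index -/

section Size

variable {K m : ℕ} (b : ℝ) (P : Finset (Vec d)) (a : Directions (partitions b P).length K m d)

theorem mem_index {Z : Block d} (hZ : Z ∈ index b P a) :
    ∃ j, Z = buildBlock ((partitions b P).get j) (a j) := by
  obtain ⟨j, rfl⟩ := List.mem_ofFn.1 hZ
  exact ⟨j, rfl⟩

theorem index_tables {Z : Block d} (hZ : Z ∈ index b P a) :
    Z.tables.length = K ∧ ∀ T ∈ Z.tables, T.funs.length = m := by
  obtain ⟨j, rfl⟩ := mem_index b P a hZ
  refine ⟨by simp [buildBlock], fun T hT => ?_⟩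
  obtain ⟨k, rfl⟩ := List.mem_ofFn.1 hT
  simp [buildTable]

theorem index_candidates_mem {Z : Block d} (hZ : Z ∈ index b P a) :
    ∀ T ∈ Z.tables, ∀ x, ∀ p ∈ T.candidates x, p ∈ P := by
  obtain ⟨j, rfl⟩ := mem_index b P a hZ
  intro T hT x p hp
  obtain ⟨k, rfl⟩ := List.mem_ofFn.1 hT
  exact mem_of_mem_partition b P (List.get_mem _ _) (mem_of_mem_buildTable_candidates hp)

theorem buildTable_words (w : ℕ) (S : List (Vec d)) (g : Fin m → Fin (d + 1) → ℝ) :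
    (buildTable S g).words w = S.length * ((m + w - 1) / w + 3) := by
  simp [Table.words, buildTable, Function.comp_def, List.map_const']

/-- Each item lies in exactly one partition, so the total does not depend on how `P` is cut. -/
theorem tableWords_index (w : ℕ) :
    tableWords w (index b P a) = P.card * (K * ((m + w - 1) / w + 3)) := by
  have h (j) : ((buildBlock ((partitions b P).get j) (a j)).tables.map fun T => T.words w).sum =
      ((partitions b P).get j).length * (K * ((m + w - 1) / w + 3)) := by
    simp only [buildBlock, List.map_ofFn, List.sum_ofFn, Function.comp_apply, buildTable_words,
      Finset.sum_const, Finset.card_univ, Fintype.card_fin, smul_eq_mul]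
    ring
  rw [tableWords, index, List.map_ofFn, List.sum_ofFn]
  simp only [Function.comp_apply, h]
  rw [← Finset.sum_mul, ← sum_length_partitions b P, ← List.sum_ofFn]
  congr 2
  conv_rhs => rw [← List.ofFn_get (partitions b P), List.map_ofFn]
  rfl

theorem funWords_index :
    funWords (index b P a) = (partitions b P).length * (K * (m * (d + 1))) := by
  simp [funWords, index, buildBlock, buildTable, List.map_ofFn, List.sum_ofFn]

end Size

/-! ### Success probability of a query -/

instance isProbabilityMeasure_gaussianDirections (t K m d : ℕ) :
    IsProbabilityMeasure (gaussianDirections t K m d) := by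
  unfold gaussianDirections
  infer_instance

/-- The deterministic core: the two good events together force success within the partition. -/
theorem buildBlock_reaches {K m B : ℕ} {S : List (Vec d)} (g : Fin K → Fin m → Fin (d + 1) → ℝ)
    {u pstar : Vec d} {τ : ℝ} (hS : pstar ∈ S) (hτ : τ ≤ ⟪pstar, u⟫_ℝ)
    (hnear : ∃ k, ∀ i, g k i ∈ collisionSet S u pstar)
    (hfar : ∑ k, collisions (collisionSet S u) (S.filter fun p => decide (⟪p, u⟫_ℝ < τ)) (g k) < B)
    (best : Option (ℝ × Vec d)) :
    Reaches τ (simHashC u (userMap (buildBlock S g).radius u) B (buildBlock S g).tables best).val := by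
  apply simHashC_reaches
  · simp only [buildBlock, List.map_ofFn, List.sum_ofFn, Function.comp_apply,
      farCount_buildTable_candidates]
    exact hfar
  · obtain ⟨k, hk⟩ := hnear
    exact ⟨buildTable S (g k), List.mem_ofFn.2 ⟨k, rfl⟩, pstar,
      (buildTable_candidates S (g k) u pstar).2 ⟨hS, hk⟩, hτ⟩

/-- By Cauchy–Schwarz every product is at most `‖pstar‖ * ‖u‖`, and `‖pstar‖` is at most the largest
norm of its own and of every earlier partition. So the search cannot end before it. -/
theorem query_index_reaches {K m B : ℕ} {b : ℝ} {P : Finset (Vec d)}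
    (a : Directions (partitions b P).length K m d) {u pstar : Vec d} {τ : ℝ}
    (hmax : ∀ p ∈ P, ⟪p, u⟫_ℝ ≤ ⟪pstar, u⟫_ℝ) (j : Fin (partitions b P).length)
    (hj : pstar ∈ (partitions b P).get j) (hτ : τ ≤ ⟪pstar, u⟫_ℝ)
    (hnear : ∃ k, ∀ i, a j k i ∈ collisionSet ((partitions b P).get j) u pstar)
    (hfar : ∑ k, collisions (collisionSet ((partitions b P).get j) u)
      (((partitions b P).get j).filter fun p => decide (⟪p, u⟫_ℝ < τ)) (a j k) < B) :
    ∃ p ∈ P, (query B (index b P a) u).val = some p ∧ τ ≤ ⟪p, u⟫_ℝ := by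
  have hlen : (index b P a).length = (partitions b P).length := by simp [index]
  have hbound (i : Fin (partitions b P).length) (hij : i ≤ j) : ∀ p ∈ P, ⟪p, u⟫_ℝ ≤
      (buildBlock ((partitions b P).get i) (a i)).maxNorm * ‖u‖ := by
    intro p hp
    refine (hmax p hp).trans ((real_inner_le_norm _ _).trans ?_)
    gcongr
    exact norm_le_maxNorm b P hij hj
  have hsplit : index b P a = (index b P a).take j ++
      buildBlock ((partitions b P).get j) (a j) :: (index b P a).drop (j + 1) := by
    have h := List.take_append_drop (j : ℕ) (index b P a)
    rw [List.drop_eq_getElem_cons (by rw [hlen]; exact j.2)] at h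
    conv_lhs => rw [← h]
    simp [index]
  have hsound₀ : Sound P u none := fun r hr => by simp at hr
  have hsound := hsound₀.searchC (fun Z hZ => index_candidates_mem b P a hZ) ‖u‖ B
  have hreach : Reaches τ (searchC u ‖u‖ B (index b P a) none).val := by
    rw [hsplit]
    refine searchC_reaches (fun Z hZ => index_candidates_mem b P a (List.mem_of_mem_take hZ)) ?_
      (hbound j le_rfl) (buildBlock_reaches (a j) hj hτ hnear hfar) hsound₀
    intro Z hZ
    obtain ⟨i, hi, rfl⟩ := List.mem_take_iff_getElem.1 hZ
    rw [lt_min_iff] at hi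
    simp only [index, List.getElem_ofFn]
    exact hbound ⟨i, _⟩ hi.1.le
  obtain ⟨⟨φ, q⟩, hr, hφ⟩ := hreach
  obtain ⟨hq, hφq⟩ := hsound _ hr
  simp only at hq hφq hφ
  refine ⟨q, hq, ?_, hφq ▸ hφ⟩
  rw [Option.mem_def] at hr
  simp only [query, normC, Cost.val_bind, Cost.val_pure, hr, Option.map_some]

/-- A query returns an item with inner product at least `τ` with probability at least `1/2`, if the
best item is near and the items below `τ` are far. -/
theorem half_le_query_prob {K m B : ℕ} {b : ℝ} {P : Finset (Vec d)} {u pstar : Vec d} {τ p₁ p₂ : ℝ}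
    (hp₁ : 0 ≤ p₁) (hp₁' : p₁ ≤ 1) (hp₂ : 0 ≤ p₂) (hnm : P.card * p₂ ^ m ≤ 1)
    (hK : (1 - p₁ ^ m) ^ K ≤ 1 / 4) (hB₀ : 0 < B) (hB : 4 * K ≤ B)
    (hmax : ∀ p ∈ P, ⟪p, u⟫_ℝ ≤ ⟪pstar, u⟫_ℝ) {S : List (Vec d)} (hS : S ∈ partitions b P)
    (hpS : pstar ∈ S) (hτ : τ ≤ ⟪pstar, u⟫_ℝ) (hu : 0 < radius S → u ≠ 0)
    (hnear : 0 < radius S →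
      p₁ ≤ srpProb (Real.arccos (⟪pstar - centroid S, u⟫_ℝ / (radius S * ‖u‖))))
    (hfar : 0 < radius S →
      srpProb (Real.arccos ((τ - ⟪centroid S, u⟫_ℝ) / (radius S * ‖u‖))) ≤ p₂) :
    1 / 2 ≤ (gaussianDirections (partitions b P).length K m d).real
      {a | ∃ p ∈ P, (query B (index b P a) u).val = some p ∧ τ ≤ ⟪p, u⟫_ℝ} := by
  obtain ⟨j, rfl⟩ := List.get_of_mem hS
  set S := (partitions b P).get j
  set γ : Measure (Fin (d + 1) → ℝ) := Measure.pi fun _ => gaussianReal 0 1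
  set μ : Measure (Fin K → Fin m → Fin (d + 1) → ℝ) := Measure.pi fun _ => Measure.pi fun _ => γ
  set ν := gaussianDirections (partitions b P).length K m d
  set L := S.filter fun p => decide (⟪p, u⟫_ℝ < τ)
  have hmeas := measurableSet_collisionSet S u
  have hR := maxOf_nonneg (S.map fun p => ‖p - centroid S‖)
  change 0 ≤ radius S at hR
  set N : Set (Fin K → Fin m → Fin (d + 1) → ℝ) :=
    {g | ∀ k, ¬ ∀ i, g k i ∈ collisionSet S u pstar}
  set F : Set (Fin K → Fin m → Fin (d + 1) → ℝ) :=
    {g | B ≤ ∑ k, collisions (collisionSet S u) L (g k)}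
  have hN : μ.real N ≤ 1 / 4 := by
    refine (no_collision_prob_le γ (hmeas pstar) hp₁ ?_).trans hK
    rcases hR.eq_or_lt with h0 | h0
    · rw [collisionSet_eq_univ_of_radius_eq_zero h0.symm u hpS]
      simpa using hp₁'
    · rw [gaussian_collisionSet h0 (hu h0) hpS]
      exact hnear h0
  have hF : μ.real F ≤ 1 / 4 := by
    refine (many_collisions_prob_le γ hmeas (q := p₂) L (fun p hp => ?_) ?_ hB₀).trans ?_
    · obtain ⟨hpS', hpτ⟩ := List.mem_filter.1 hp
      have hpτ := of_decide_eq_true hpτ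
      rcases hR.eq_or_lt with h0 | h0
      -- With radius `0` all items of `S` equal `pstar`, so none is far.
      · exfalso
        rw [eq_centroid_of_radius_eq_zero h0.symm hpS',
          ← eq_centroid_of_radius_eq_zero h0.symm hpS] at hpτ
        linarith
      · rw [gaussian_collisionSet h0 (hu h0) hpS']
        refine (srpProb_arccos_mono ?_).trans (hfar h0)
        rw [inner_sub_left]
        gcongr
    · refine le_trans ?_ hnm
      gcongr
      exact (List.length_filter_le _ _).trans (length_partition_le b P hS)
    · rw [div_le_div_iff₀ (by exact_mod_cast hB₀) (by norm_num)]
      have : (4 * K : ℝ) ≤ B := by exact_mod_cast hB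
      linarith
  have hNm : MeasurableSet N := by
    have : N = ⋂ k, (⋂ i, (fun g : Fin K → Fin m → Fin (d + 1) → ℝ => g k i) ⁻¹'
        collisionSet S u pstar)ᶜ := by
      ext g; simp [N]
    rw [this]
    exact MeasurableSet.iInter fun k =>
      (MeasurableSet.iInter fun i => (hmeas pstar).preimage (by fun_prop)).compl
  have hFm : MeasurableSet F := by
    refine measurableSet_le measurable_const (Finset.measurable_fun_sum _ fun k _ => ?_)
    exact (measurable_collisions hmeas L).comp (measurable_pi_apply k)
  -- Only the directions of partition `j` matter, and their marginal law is `μ`.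
  have hbad : ν.real ((fun a => a j) ⁻¹' (N ∪ F)) ≤ 1 / 2 := by
    have hmp : MeasurePreserving (fun a : Directions (partitions b P).length K m d => a j) ν μ :=
      measurePreserving_eval (fun _ => μ) j
    rw [hmp.measureReal_preimage (hNm.union hFm).nullMeasurableSet]
    linarith [measureReal_union_le (μ := μ) N F]
  have hcompl := probReal_compl_eq_one_sub (μ := ν)
    ((hNm.union hFm).preimage (measurable_pi_apply j))
  -- Success is only bounded below by a measurable event, so its own measurability is not needed.
  have hsub : ((fun a : Directions (partitions b P).length K m d => a j) ⁻¹' (N ∪ F))ᶜ ⊆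
      {a | ∃ p ∈ P, (query B (index b P a) u).val = some p ∧ τ ≤ ⟪p, u⟫_ℝ} := by
    intro a ha
    simp only [Set.mem_compl_iff, Set.mem_preimage, Set.mem_union, not_or, N, F,
      Set.mem_ofPred_eq, not_le] at ha
    obtain ⟨k, hk⟩ := not_forall.1 ha.1
    exact query_index_reaches a hmax j hpS hτ ⟨k, not_not.1 hk⟩ ha.2
  have := measureReal_mono (μ := ν) hsub
  linarith

/-! ### The parameters -/

/-- The number of tables and of hash functions per table. -/
theorem exists_parameters {p₁ p₂ ρ : ℝ} (hp₂ : 0 < p₂) (hp : p₂ < p₁) (hp₁ : p₁ ≤ 1)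
    (hρ : ρ = Real.log (1 / p₁) / Real.log (1 / p₂)) :
    0 < Real.logb (1 / p₂) 2 ∧ ∀ n : ℕ, 2 ≤ n → ∃ K m : ℕ, 0 < K ∧ 0 < m ∧
      (K : ℝ) ≤ (2 / p₁ + 1) * (n : ℝ) ^ ρ ∧
      (m : ℝ) ≤ (1 + (Real.logb (1 / p₂) 2)⁻¹) * Real.logb (1 / p₂) n ∧
      n * p₂ ^ m ≤ 1 ∧ (1 - p₁ ^ m) ^ K ≤ 1 / 4 := by
  have hp₁0 : 0 < p₁ := hp₂.trans hp
  have hinv : 1 < 1 / p₂ := one_lt_one_div hp₂ (hp.trans_le hp₁)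
  have hlog2 : 0 < Real.log (1 / p₂) := Real.log_pos hinv
  have hlog1 : 0 ≤ Real.log (1 / p₁) := Real.log_nonneg ((one_le_div hp₁0).2 hp₁)
  have hℓ : 0 < Real.logb (1 / p₂) 2 := Real.logb_pos hinv one_lt_two
  refine ⟨hℓ, fun n hn => ?_⟩
  have hn0 : (0 : ℝ) < n := by positivity
  have hn2 : (2 : ℝ) ≤ n := by exact_mod_cast hn
  have hρ0 : 0 ≤ ρ := hρ ▸ div_nonneg hlog1 hlog2.le
  have hN : 1 ≤ (n : ℝ) ^ ρ := Real.one_le_rpow (by linarith) hρ0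
  set lam := Real.logb (1 / p₂) n with hlam
  have hlam2 : Real.logb (1 / p₂) 2 ≤ lam := Real.logb_le_logb_of_le hinv two_pos hn2
  have hlam0 : 0 < lam := hℓ.trans_le hlam2
  have hx0 : 0 < 2 / p₁ * (n : ℝ) ^ ρ := by positivity
  have hm_ge := Nat.le_ceil lam
  have hm_lt := Nat.ceil_lt_add_one hlam0.le
  have hK_ge := Nat.le_ceil (2 / p₁ * (n : ℝ) ^ ρ)
  have hK_lt := Nat.ceil_lt_add_one hx0.le
  -- In `K`, the factor `1 / p₁` pays for rounding `m` up, and the `2` makes the expected number of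
  -- tables containing the best item at least `2`.
  set m := ⌈lam⌉₊
  set K := ⌈2 / p₁ * (n : ℝ) ^ ρ⌉₊
  refine ⟨K, m, Nat.ceil_pos.2 hx0, Nat.ceil_pos.2 hlam0, ?_, ?_, ?_, ?_⟩
  · linarith
  -- As `n ≥ 2`, the `+ 1` from rounding is absorbed into a multiple of the logarithm.
  · have : 1 ≤ (Real.logb (1 / p₂) 2)⁻¹ * lam := by
      rw [inv_mul_eq_div, one_le_div hℓ]
      exact hlam2
    linarith
  · have h1 : (n : ℝ) ≤ (1 / p₂) ^ m := by
      rw [← Real.rpow_natCast, ← Real.logb_le_iff_le_rpow hinv hn0]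
      exact hm_ge
    calc (n : ℝ) * p₂ ^ m ≤ (1 / p₂) ^ m * p₂ ^ m := by gcongr
      _ = 1 := by rw [← mul_pow, one_div_mul_cancel hp₂.ne', one_pow]
  -- This is where `ρ` comes from: `p₁ ^ (log_{1/p₂} n) = n ^ (-ρ)`.
  · have hNp : p₁ ^ lam * (n : ℝ) ^ ρ = 1 := by
      rw [Real.rpow_def_of_pos hp₁0, Real.rpow_def_of_pos hn0, ← Real.exp_add, Real.exp_eq_one_iff,
        hρ, hlam, Real.logb, one_div, one_div, Real.log_inv, Real.log_inv]
      have : Real.log p₂ ≠ 0 := by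
        rw [one_div, Real.log_inv] at hlog2
        linarith
      field_simp
      ring
    have hpm : p₁ * p₁ ^ lam ≤ p₁ ^ m := by
      rw [← Real.rpow_natCast, mul_comm, ← Real.rpow_add_one hp₁0.ne']
      exact Real.rpow_le_rpow_of_exponent_ge hp₁0 hp₁ hm_lt.le
    have hKp : 2 ≤ K * p₁ ^ m := by
      calc 2 = (2 / p₁ * (n : ℝ) ^ ρ) * (p₁ * p₁ ^ lam) := by
            field_simp
            linear_combination -hNp
        _ ≤ K * p₁ ^ m := by gcongr
    have hpm1 : p₁ ^ m ≤ 1 := pow_le_one₀ hp₁0.le hp₁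
    calc (1 - p₁ ^ m) ^ K ≤ Real.exp (-p₁ ^ m) ^ K := by
          refine pow_le_pow_left₀ (by linarith) ?_ K
          linarith [Real.add_one_le_exp (-p₁ ^ m)]
      _ = Real.exp (-(K * p₁ ^ m)) := by rw [← Real.exp_nat_mul]; ring_nf
      _ ≤ Real.exp (-1) * Real.exp (-1) := by
          rw [← Real.exp_add]
          exact Real.exp_le_exp.2 (by linarith)
      _ ≤ 1 / 2 * (1 / 2) := by
          have : Real.exp (-1) ≤ 1 / 2 := by
            rw [Real.exp_neg, ← one_div]
            exact one_div_le_one_div_of_le two_pos (by linarith [Real.add_one_le_exp 1])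
          gcongr
      _ = 1 / 4 := by norm_num

/-- Words of the tables of `m` hash functions, for words of `⌈log₂ n⌉` bits. -/
theorem key_words_le {β μ : ℝ} (hβ : 1 < β) (hμ : 0 ≤ μ) {n m : ℕ} (hn : 2 ≤ n)
    (hm : (m : ℝ) ≤ μ * Real.logb β n) :
    (((m + Nat.clog 2 n - 1) / Nat.clog 2 n + 3 : ℕ) : ℝ) ≤ μ * Real.logb β 2 + 4 := by
  set w := Nat.clog 2 n
  have hw : 0 < w := Nat.clog_pos (by norm_num) hn
  have hw' : (0 : ℝ) < w := by exact_mod_cast hw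
  -- Since `n ≤ 2 ^ w`, a key of `O(log n)` bits fits into a constant number of words.
  have hlog : Real.logb β n ≤ w * Real.logb β 2 := by
    rw [← Real.logb_pow]
    refine Real.logb_le_logb_of_le hβ (by positivity) ?_
    exact_mod_cast Nat.le_pow_clog (by norm_num) n
  have h1 : (((m + w - 1) / w : ℕ) : ℝ) ≤ (m + w - 1 : ℕ) / (w : ℝ) := Nat.cast_div_le
  have h2 : ((m + w - 1 : ℕ) : ℝ) ≤ m + w := by exact_mod_cast Nat.sub_le _ _
  have h3 : ((m + w - 1 : ℕ) : ℝ) / (w : ℝ) ≤ μ * Real.logb β 2 + 1 := by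
    rw [div_le_iff₀ hw']
    have := mul_le_mul_of_nonneg_left hlog hμ
    linarith
  push_cast
  linarith

/-- The centroid is an average. Applied to the maximizer, this makes the shifted product
nonnegative, so that dividing it by `c` lowers it. -/
theorem inner_centroid_le {S : List (Vec d)} (hS : S ≠ []) {u : Vec d} {s : ℝ}
    (h : ∀ p ∈ S, ⟪p, u⟫_ℝ ≤ s) : ⟪centroid S, u⟫_ℝ ≤ s := by
  have hsum : ⟪S.sum, u⟫_ℝ ≤ S.length * s := by
    clear hS
    induction S with
    | nil => simp
    | cons p S ih =>
      have h1 := h p (by simp)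
      have h2 := ih fun q hq => h q (List.mem_cons_of_mem _ hq)
      rw [List.sum_cons, inner_add_left, List.length_cons, Nat.cast_add_one]
      linarith
  have hlen : (0 : ℝ) < S.length := by exact_mod_cast List.length_pos_iff.2 hS
  rw [centroid, real_inner_smul_left, inv_mul_le_iff₀ hlen]
  exact hsum

theorem query_steps_bound {t d K m : ℕ} (ht : 1 ≤ t) (hd : 1 ≤ d) (hm : 1 ≤ m) :
    2 * d + 1 + t * (d + 4 + (K * (m * (2 * (d + 1) + 1) + (m + 1)) + 4 * K * (2 * d + 1))) ≤
      8 * (t * d) + 7 * (t * (K * (m * d))) + 12 * (t * (K * d)) := by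
  have h1 : d ≤ t * d := Nat.le_mul_of_pos_left d ht
  have h2 : m * (2 * (d + 1) + 1) + (m + 1) ≤ 7 * (m * d) := by nlinarith
  calc _ ≤ 3 * (t * d) + t * (5 * d + (K * (7 * (m * d)) + 4 * K * (3 * d))) := by
        gcongr <;> omega
    _ = _ := by ring

/-- Factors missing on the left are supplied by `1 ≤ N` and `1 ≤ ν * lam`. -/
theorem size_products_le {t d K m N lam κ μ ν : ℝ} (ht : 1 ≤ t) (hd : 1 ≤ d) (hK₀ : 0 ≤ K) (hμ : 0 ≤ μ)
    (hN : 1 ≤ N) (hlam : 0 < lam) (hK : K ≤ κ * N) (hm : m ≤ μ * lam) (hν : 1 ≤ ν * lam) :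
    t * d ≤ ν * (t * (d * N * lam)) ∧ t * (K * (m * d)) ≤ κ * μ * (t * (d * N * lam)) ∧
      t * (K * d) ≤ κ * ν * (t * (d * N * lam)) := by
  have hK' : 0 ≤ κ * N := hK₀.trans hK
  refine ⟨?_, ?_, ?_⟩
  · calc t * d = t * d * (1 * 1) := by ring
      _ ≤ t * d * (N * (ν * lam)) := by gcongr
      _ = _ := by ring
  · calc t * (K * (m * d)) ≤ t * (K * (μ * lam * d)) := by gcongr
      _ ≤ t * (κ * N * (μ * lam * d)) := by gcongr
      _ = _ := by ring
  · calc t * (K * d) = t * d * (K * 1) := by ring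
      _ ≤ t * d * (κ * N * (ν * lam)) := by gcongr
      _ = _ := by ring

end SAALSH

end

/-! ### Assembly of the bounds and of both guarantees -/

theorem theorem2 (p₁ p₂ : ℝ) (hp₂ : 0 < p₂) (hp : p₂ < p₁) (hp₁ : p₁ ≤ 1) (ρ : ℝ)
    (hρ : ρ = Real.log (1 / p₁) / Real.log (1 / p₂)) :
    -- constants of the bounds, depending on `p₁` and `p₂` only
    ∃ C : ℝ, 0 < C ∧ ∀ n : ℕ, 2 ≤ n →
    -- number of tables, hash functions per table, candidates per partition
    ∃ K m B : ℕ, ∀ (d : ℕ) (P : Finset (SAALSH.Vec d)) (b : ℝ), P.card = n → b < 1 →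
      -- query time
      (∀ (a : SAALSH.Directions (SAALSH.partitions b P).length K m d) (u : SAALSH.Vec d),
        ((SAALSH.query B (SAALSH.index b P a) u).steps : ℝ) ≤
          C * (SAALSH.partitions b P).length *
            (d * (n : ℝ) ^ ρ * Real.logb (1 / p₂) n)) ∧
      -- space of the hash tables
      (∀ a : SAALSH.Directions (SAALSH.partitions b P).length K m d,
        (SAALSH.tableWords (Nat.clog 2 n) (SAALSH.index b P a) : ℝ) ≤ C * (n : ℝ) ^ (1 + ρ)) ∧
      -- space including the item vectors and the hash functions
      (∀ a : SAALSH.Directions (SAALSH.partitions b P).length K m d,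
        (SAALSH.totalWords (Nat.clog 2 n) n (SAALSH.index b P a) : ℝ) ≤
          C * ((n : ℝ) ^ (1 + ρ) + d * n +
            (SAALSH.partitions b P).length * (d * (n : ℝ) ^ ρ * Real.logb (1 / p₂) n))) ∧
      -- correctness
      ∀ (c : ℝ) (u pstar : SAALSH.Vec d) (S : List (SAALSH.Vec d)), 1 < c →
        pstar ∈ P → (∀ p ∈ P, ⟪p, u⟫_ℝ ≤ ⟪pstar, u⟫_ℝ) →
        S ∈ SAALSH.partitions b P → pstar ∈ S →
        (0 < SAALSH.radius S →
          p₁ ≤ SAALSH.srpProb (Real.arccos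
            (⟪pstar - SAALSH.centroid S, u⟫_ℝ / (SAALSH.radius S * ‖u‖)))) →
        -- thresholds `S₀ = ⟪pstar, u⟫` and `S₀ / c` for the inner product with the items
        (0 < ⟪pstar, u⟫_ℝ →
          (0 < SAALSH.radius S →
            SAALSH.srpProb (Real.arccos
              ((⟪pstar, u⟫_ℝ / c - ⟪SAALSH.centroid S, u⟫_ℝ) / (SAALSH.radius S * ‖u‖))) ≤ p₂) →
          1 / 2 ≤ (SAALSH.gaussianDirections (SAALSH.partitions b P).length K m d).real
            {a | ∃ p ∈ P, (SAALSH.query B (SAALSH.index b P a) u).val = some p ∧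
              ⟪pstar, u⟫_ℝ / c ≤ ⟪p, u⟫_ℝ}) ∧
        -- thresholds `S₀ = ⟪pstar - centroid, u⟫` and `S₀ / c` for the shifted inner product
        ((0 < SAALSH.radius S →
            SAALSH.srpProb (Real.arccos
              (⟪pstar - SAALSH.centroid S, u⟫_ℝ / (c * SAALSH.radius S * ‖u‖))) ≤ p₂) →
          1 / 2 ≤ (SAALSH.gaussianDirections (SAALSH.partitions b P).length K m d).real
            {a | ∃ p ∈ P, (SAALSH.query B (SAALSH.index b P a) u).val = some p ∧
              ⟪pstar - SAALSH.centroid S, u⟫_ℝ / c ≤ ⟪p - SAALSH.centroid S, u⟫_ℝ ∧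
              (0 ≤ ⟪SAALSH.centroid S, u⟫_ℝ → ⟪pstar, u⟫_ℝ / c ≤ ⟪p, u⟫_ℝ)}) := by
  obtain ⟨hℓ, hpar⟩ := SAALSH.exists_parameters hp₂ hp hp₁ hρ
  have hp₁0 : 0 < p₁ := hp₂.trans hp
  have hinv : 1 < 1 / p₂ := one_lt_one_div hp₂ (hp.trans_le hp₁)
  have hρ0 : 0 ≤ ρ := by
    rw [hρ]
    exact div_nonneg (Real.log_nonneg ((one_le_div hp₁0).2 hp₁)) (Real.log_pos hinv).le
  obtain ⟨ν, hν⟩ : ∃ ν, ν = (Real.logb (1 / p₂) 2)⁻¹ := ⟨_, rfl⟩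
  obtain ⟨κ, hκ⟩ : ∃ κ, κ = 2 / p₁ + 1 := ⟨_, rfl⟩
  obtain ⟨σ, hσ⟩ : ∃ σ, σ = (1 + ν) * Real.logb (1 / p₂) 2 + 4 := ⟨_, rfl⟩
  have hν0 : 0 < ν := hν ▸ inv_pos.2 hℓ
  have hκ0 : 0 < κ := hκ ▸ by positivity
  have hσ0 : 0 < σ := hσ ▸ by positivity
  have hκσ : 0 < κ * σ := mul_pos hκ0 hσ0
  have hκν : 0 < κ * ν := mul_pos hκ0 hν0
  -- One constant serves four purposes: query time, table words, item vectors, and hash functions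
  -- with the numbers stored per partition.
  obtain ⟨C, hC⟩ : ∃ C, C = 8 * ν + 7 * κ * (1 + ν) + 12 * κ * ν + κ * σ + 1 := ⟨_, rfl⟩
  have hC₁ : 8 * ν + 7 * κ * (1 + ν) + 12 * κ * ν ≤ C := by linarith
  have hC₂ : κ * σ ≤ C := by nlinarith
  have hC₃ : 1 ≤ C := by nlinarith
  have hC₄ : 2 * (κ * (1 + ν)) + 2 * ν ≤ C := by nlinarith
  refine ⟨C, by linarith, fun n hn => ?_⟩
  obtain ⟨K, m, hK0, hm0, hK, hm, hnm, hfail⟩ := hpar n hn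
  refine ⟨K, m, 4 * K, fun d P b hP _ => ?_⟩
  -- The space of dimension `0` has a single vector, too few for `n ≥ 2` items.
  have hd : 1 ≤ d := by
    by_contra! h
    obtain rfl : d = 0 := by omega
    have := Finset.card_le_one_of_subsingleton P
    omega
  have ht : 1 ≤ (SAALSH.partitions b P).length := SAALSH.partitions_length_pos b P (by omega)
  have hn0 : (0 : ℝ) < n := by positivity
  have hN1 : 1 ≤ (n : ℝ) ^ ρ := Real.one_le_rpow (by exact_mod_cast (by omega : 1 ≤ n)) hρ0
  have hNn : (n : ℝ) ^ (1 + ρ) = n * (n : ℝ) ^ ρ := by rw [Real.rpow_add hn0, Real.rpow_one]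
  have hlam : 1 ≤ ν * Real.logb (1 / p₂) n := by
    rw [hν, inv_mul_eq_div, one_le_div hℓ]
    exact Real.logb_le_logb_of_le hinv two_pos (by exact_mod_cast hn)
  rw [← hν] at hm
  rw [← hκ] at hK
  have hwords := SAALSH.key_words_le hinv (by positivity : 0 ≤ 1 + ν) hn hm
  rw [← hσ] at hwords
  have hlam0 : 0 < Real.logb (1 / p₂) n := by
    by_contra! h
    nlinarith
  obtain ⟨h1, h2, h3⟩ := SAALSH.size_products_le
    (t := (SAALSH.partitions b P).length) (d := d) (by exact_mod_cast ht) (by exact_mod_cast hd)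
    K.cast_nonneg (by positivity) hN1 hlam0 hK hm hlam
  set t := (SAALSH.partitions b P).length
  set W : ℝ := d * (n : ℝ) ^ ρ * Real.logb (1 / p₂) n
  have hW : 0 ≤ t * W := by positivity
  have htable (a : SAALSH.Directions t K m d) :
      (SAALSH.tableWords (Nat.clog 2 n) (SAALSH.index b P a) : ℝ) ≤
        κ * σ * (n : ℝ) ^ (1 + ρ) := by
    rw [SAALSH.tableWords_index, hP, Nat.cast_mul, Nat.cast_mul, hNn]
    calc (n : ℝ) * (K * ((m + Nat.clog 2 n - 1) / Nat.clog 2 n + 3 : ℕ))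
        ≤ n * (κ * (n : ℝ) ^ ρ * σ) := by gcongr
      _ = _ := by ring
  have hn1 : 0 ≤ (n : ℝ) ^ (1 + ρ) := by positivity
  refine ⟨fun a u => ?_, fun a => ?_, fun a => ?_, ?_⟩
  · have hs := (SAALSH.query_steps_le u (4 * K) (SAALSH.index b P a)
      fun Z hZ => SAALSH.index_tables b P a hZ)
    rw [show (SAALSH.index b P a).length = t by simp [SAALSH.index, t]] at hs
    have hs' := hs.trans (SAALSH.query_steps_bound ht hd hm0)
    calc ((SAALSH.query (4 * K) (SAALSH.index b P a) u).steps : ℝ)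
        ≤ 8 * (t * d) + 7 * (t * (K * (m * d))) + 12 * (t * (K * d)) := by exact_mod_cast hs'
      _ ≤ 8 * (ν * (t * W)) + 7 * (κ * (1 + ν) * (t * W)) + 12 * (κ * ν * (t * W)) := by gcongr
      _ = (8 * ν + 7 * κ * (1 + ν) + 12 * κ * ν) * (t * W) := by ring
      _ ≤ C * (t * W) := by gcongr
      _ = _ := by ring
  · refine (htable a).trans ?_
    gcongr
  · have hf : SAALSH.funWords (SAALSH.index b P a) ≤ 2 * (t * (K * (m * d))) := by
      rw [SAALSH.funWords_index]
      calc t * (K * (m * (d + 1))) ≤ t * (K * (m * (2 * d))) := by gcongr; omega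
        _ = _ := by ring
    have hl : 2 * (SAALSH.index b P a).length ≤ 2 * (t * d) := by
      rw [show (SAALSH.index b P a).length = t by simp [SAALSH.index, t]]
      gcongr
      exact Nat.le_mul_of_pos_right t hd
    have hf' : (SAALSH.funWords (SAALSH.index b P a) : ℝ) ≤ 2 * (t * (K * (m * d))) := by
      exact_mod_cast hf
    have hl' : ((2 * (SAALSH.index b P a).length : ℕ) : ℝ) ≤ 2 * (t * d) := by exact_mod_cast hl
    rw [SAALSH.totalWords, Nat.cast_add, Nat.cast_add, Nat.cast_add, Nat.cast_mul n d]
    have hdn : (0 : ℝ) ≤ d * n := by positivity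
    calc _ ≤ κ * σ * (n : ℝ) ^ (1 + ρ) + 2 * (κ * (1 + ν) * (t * W)) + 2 * (ν * (t * W)) + n * d := by
          linarith [htable a]
      _ = κ * σ * (n : ℝ) ^ (1 + ρ) + 1 * (d * n) + (2 * (κ * (1 + ν)) + 2 * ν) * (t * W) := by ring
      _ ≤ C * (n : ℝ) ^ (1 + ρ) + C * (d * n) + C * (t * W) := by gcongr
      _ = _ := by ring
  · intro c u pstar S hc hpP hmax hS hpS hnear
    have hc0 : 0 < c := one_pos.trans hc
    have hB₀ : 0 < 4 * K := by omega
    have main {τ : ℝ} := SAALSH.half_le_query_prob (τ := τ) hp₁0.le hp₁ hp₂.le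
      (by rw [hP]; exact hnm) hfail hB₀ le_rfl hmax hS hpS
    refine ⟨fun hpos hfar => ?_, fun hfar => ?_⟩
    · refine main (div_le_self hpos.le hc.le) (fun _ hu => ?_) hnear hfar
      simp [hu] at hpos
    · have hcen : ⟪SAALSH.centroid S, u⟫_ℝ ≤ ⟪pstar, u⟫_ℝ :=
        SAALSH.inner_centroid_le (List.ne_nil_of_mem hpS)
          fun p hp => hmax p (SAALSH.mem_of_mem_partition b P hS hp)
      have hgap : 0 ≤ ⟪pstar - SAALSH.centroid S, u⟫_ℝ := by
        rw [inner_sub_left]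
        linarith
      have hgapc := div_le_self hgap hc.le
      -- Adding `⟪centroid S, u⟫` turns the shifted guarantee into a threshold for plain inner
      -- products, the quantity the query compares.
      refine (main (τ := ⟪SAALSH.centroid S, u⟫_ℝ + ⟪pstar - SAALSH.centroid S, u⟫_ℝ / c)
        ?_ ?_ hnear ?_).trans (measureReal_mono ?_)
      · rw [inner_sub_left] at hgapc ⊢
        linarith
      -- For `u = 0` both hypotheses concern `arccos 0`, giving `p₁ ≤ p₂`, a contradiction.
      · intro hR hu
        have h1 := hnear hR
        have h2 := hfar hR
        simp only [hu, norm_zero, mul_zero, div_zero] at h1 h2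
        linarith
      · intro hR
        convert hfar hR using 3
        rw [add_sub_cancel_left, div_div, mul_assoc]
      · rintro a ⟨p, hp, hq, hτ⟩
        refine ⟨p, hp, hq, ?_, fun hcpos => ?_⟩
        · rw [inner_sub_left p]
          linarith
        -- A nonnegative centroid term only decreases when divided by `c`, so the shifted guarantee
        -- implies the unshifted one.
        · have : ⟪SAALSH.centroid S, u⟫_ℝ / c ≤ ⟪SAALSH.centroid S, u⟫_ℝ := div_le_self hcpos hc.le
          rw [inner_sub_left, sub_div] at hτ
          linarith
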